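/- Let $P$ be a (Hausdorff, finite-dimensional) smooth manifold and $A\to P$ a smooth real vector bundle of finite rank with dual bundle $A^*$. A *Lie algebroid* structure on a vector bundle $V\to P$ is a Lie bracket on $\Gamma(V)$ together with a bundle map (anchor) $a:V\to TP$ with $a[X,Y]=[aX,aY]$ and $[X,fY]=f[X,Y]+(a(X)f)Y$. It defines a differential on $\Gamma(\wedge^\bullet V^*)$, $$(d\omega)(X_0,\dots,X_k)=\sum_i(-1)^i a(X_i)\,\omega(\dots,\widehat{X_i},\dots)+\sum_{i<j}(-1)^{i+j}\omega([X_i,X_j],\dots,\widehat{X_i},\dots,\widehat{X_j},\dots),$$ Lie derivatives $\langle L_X w,Y\rangle=a(X)\langle w,Y\rangle-\langle w,[X,Y]\rangle$ of $w\in\Gamma(V^*)$, and the Schouten bracket on $\Gamma(\wedge^\bullet V)$, i.e. the extension of the bracket of sections with $[X,f]=a(X)f$, $[f,g]=0$, $[P,Q]=-(-1)^{(p-1)(q-1)}[Q,P]$ and $[P,Q\wedge R]=[P,Q]\wedge R+(-1)^{(p-1)q}Q\wedge[P,R]$ for $P,Q,R$ of degrees $p,q,r$; multivectors are evaluated by $(X_1\wedge\dots\wedge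 X_k)(w_1,\dots,w_k)=\det\langle w_i,X_j\rangle$. A *Lie bialgebroid* $(A,A^*)$ consists of Lie algebroid structures on $A$ and on $A^*$ such that the differential $d_*$ on $\Gamma(\wedge^\bullet A)$ given by the structure of $A^*$ is a derivation of the Schouten bracket given by the structure of $A$: $d_*[P,Q]=[d_*P,Q]+(-1)^{p-1}[P,d_*Q]$ for $P\in\Gamma(\wedge^pA)$, $Q\in\Gamma(\wedge^qA)$. Let $d$ be the differential on $\Gamma(\wedge^\bullet A^*)$ given by the structure of $A$. On $E=A\oplus A^*$ put $(X_1+\xi_1,X_2+\xi_2)_\pm=\tfrac12(\langle\xi_1,X_2\rangle\pm\langle\xi_2,X_1\rangle)$ and, for $e_i=X_i+\xi_i\in\Gamma(E)$, $$[e_1,e_2]=\big([X_1,X_2]+L_{\xi_1}X_2-L_{\xi_2}X_1-d_*(e_1,e_2)_-\big)+\big([\xi_1,\xi_2]+L_{X_1}\xi_2-L_{X_2}\xi_1+d(e_1,e_2)_-\big).$$ A *Dirac subbundle* of $E$ is a smooth subbundle $L\subset E$ each of whose fibres is maximal among the subspaces of the fibre of $E$ that are isotropic for $(\cdot,\cdot)_+$,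 and such that $\Gamma(L)$ is closed under $[\cdot,\cdot]$. **Theorem 6.1.** Let $(A,A^*)$ be a Lie bialgebroid. 1. Let $H:A^*\to A$ be a bundle map. Its graph $A_H=\{H\xi+\xi\mid\xi\in A^*\}$ is a Dirac subbundle of $A\oplus A^*$ if and only if $H$ is skew-symmetric and $$d_*H+\tfrac12[H,H]=0,$$ where $H$ is considered as the section $H(\xi,\eta)=\langle\eta,H\xi\rangle$ of $\wedge^2A$ and $[\cdot,\cdot]$ is the Schouten bracket of $A$. 2. Dually, let $I:A\to A^*$ be a bundle map. Its graph $A_I=\{X+IX\mid X\in A\}$ is a Dirac subbundle of $A\oplus A^*$ if and only if $I$ is skew-symmetric and $$dI+\tfrac12[I,I]=0,$$ where $I$ is considered as the section $I(X,Y)=\langle IX,Y\rangle$ of $\wedge^2A^*$ and $[\cdot,\cdot]$ is the Schouten bracket on $\Gamma(\wedge^\bullet A^*)$ given by the structure of $A^*$. -/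

import Mathlib

open Bundle
open scoped Manifold ContDiff Topology

namespace Algebroid

noncomputable section

/-- The space `Γ(V)` of smooth sections of a vector bundle `V` (with model fibre `F`) over a
manifold modelled on `EM`. -/
abbrev Sec (EM : Type*) [NormedAddCommGroup EM] [NormedSpace ℝ EM]
    {M : Type*} [TopologicalSpace M] [ChartedSpace EM M]
    (F : Type*) [NormedAddCommGroup F] [NormedSpace ℝ F]
    (V : M → Type*) [TopologicalSpace (TotalSpace F V)] [∀ x, TopologicalSpace (V x)]
    [FiberBundle F V] :=
  Cₛ^∞⟮𝓘(ℝ, EM); F, V⟯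

/-- The dual vector bundle `V*`; its model fibre is `F →L[ℝ] ℝ`. -/
abbrev DualBundle {M : Type*} (V : M → Type*) [∀ x, AddCommGroup (V x)] [∀ x, Module ℝ (V x)]
    [∀ x, TopologicalSpace (V x)] : M → Type _ :=
  fun x => V x →L[ℝ] Bundle.Trivial M ℝ x

/-! ### Sections and tensorial expressions -/

section Sections

variable {EM : Type*} [NormedAddCommGroup EM] [NormedSpace ℝ EM]
  {M : Type*} [TopologicalSpace M] [ChartedSpace EM M]
  {F : Type*} [NormedAddCommGroup F] [NormedSpace ℝ F]
  {V : M → Type*} [TopologicalSpace (TotalSpace F V)] [∀ x, TopologicalSpace (V x)]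
  [∀ x, AddCommGroup (V x)] [∀ x, Module ℝ (V x)]
  [FiberBundle F V] [VectorBundle ℝ F V]

/-- The product of a smooth function and a smooth section. -/
def smulSec (f : C^∞⟮𝓘(ℝ, EM), M; ℝ⟯) (s : Sec EM F V) : Sec EM F V :=
  ⟨fun x => f x • s x, f.contMDiff.smul_section s.contMDiff⟩

/-- A function-valued expression in a section which is linear over the smooth functions. -/
structure IsTensorial (φ : Sec EM F V → M → ℝ) : Prop where
  add : ∀ s t x, φ (s + t) x = φ s x + φ t x
  smul : ∀ (f : C^∞⟮𝓘(ℝ, EM), M; ℝ⟯) s x, φ (smulSec f s) x = f x * φ s x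

variable [FiniteDimensional ℝ EM] [T2Space M] [IsManifold 𝓘(ℝ, EM) ∞ M]

theorem exists_bump {u : Set M} (x : M) (hu : u ∈ 𝓝 x) :
    ∃ ψ : C^∞⟮𝓘(ℝ, EM), M; ℝ⟯, ψ x = 1 ∧ tsupport ψ ⊆ u := by
  obtain ⟨f, -, hf⟩ := (SmoothBumpFunction.nhds_basis_tsupport (I := 𝓘(ℝ, EM)) x).mem_iff.1 hu
  exact ⟨⟨f, f.contMDiff⟩, f.eq_one, hf⟩

variable [ContMDiffVectorBundle ∞ F V 𝓘(ℝ, EM)]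

theorem exists_sec_eq (x : M) (v : V x) : ∃ s : Sec EM F V, s x = v := by
  let e := trivializationAt F V x
  have hx : x ∈ e.baseSet := FiberBundle.mem_baseSet_trivializationAt F V x
  obtain ⟨u, hu, hsm⟩ := FiberBundle.exists_contMDiffOn_extend (k := ∞) 𝓘(ℝ, EM) F v
  obtain ⟨u', hu', hopen, hxu'⟩ := mem_nhds_iff.1 hu
  obtain ⟨ψ, hψ, hsupp⟩ := exists_bump (EM := EM) x (hopen.mem_nhds hxu')
  refine ⟨⟨fun y => ((ψ : M → ℝ) • FiberBundle.extend F v) y,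
    ContMDiffOn.smul_section_of_tsupport ψ.contMDiff.contMDiffOn hopen hsupp (hsm.mono hu')⟩, ?_⟩
  change ψ x • FiberBundle.extend F v x = v
  rw [hψ, one_smul, FiberBundle.extend_apply_self]

variable [FiniteDimensional ℝ F]

/-- A tensorial expression vanishes at each point where the section vanishes. -/
theorem IsTensorial.eq_zero {φ : Sec EM F V → M → ℝ} (hφ : IsTensorial φ) {s : Sec EM F V} {x : M}
    (hs : s x = 0) : φ s x = 0 := by
  classical
  let e := trivializationAt F V x
  have hx : x ∈ e.baseSet := FiberBundle.mem_baseSet_trivializationAt F V x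
  let b := Module.finBasis ℝ F
  obtain ⟨ψ, hψ, hsupp⟩ := exists_bump (EM := EM) x (e.open_baseSet.mem_nhds hx)
  have : ContMDiffVectorBundle 1 F V 𝓘(ℝ, EM) := ContMDiffVectorBundle.of_le (n := ∞) (by simp)
  let t (i) : Sec EM F V := ⟨fun y => ((ψ : M → ℝ) • e.localFrame b i) y,
    ContMDiffOn.smul_section_of_tsupport ψ.contMDiff.contMDiffOn e.open_baseSet hsupp
      (e.contMDiffOn_localFrame_baseSet ∞ b i)⟩
  have hc (i) : ContMDiff 𝓘(ℝ, EM) 𝓘(ℝ, ℝ) ∞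
      (fun y => ψ y * e.localFrameCoeff 𝓘(ℝ, EM) b i y (s y)) := by
    intro y
    by_cases hy : y ∈ tsupport ψ
    · exact ψ.contMDiff.contMDiffAt.mul
        (contMDiffAt_localFrameCoeff b (hsupp hy) (s.contMDiff y) i)
    · refine (contMDiffAt_const (c := (0 : ℝ))).congr_of_eventuallyEq ?_
      filter_upwards [(isClosed_tsupport ψ).isOpen_compl.mem_nhds hy] with z hz
      rw [image_eq_zero_of_notMem_tsupport hz, zero_mul]
  let c (i) : C^∞⟮𝓘(ℝ, EM), M; ℝ⟯ := ⟨_, hc i⟩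
  have hsum : smulSec (ψ * ψ) s = ∑ i, smulSec (c i) (t i) := by
    ext y
    have hco : ((∑ i, smulSec (c i) (t i) : Sec EM F V) : ∀ y, V y) y
        = ∑ i, c i y • t i y := by
      rw [← ContMDiffSection.coeAddHom_apply, map_sum, Finset.sum_apply]
      rfl
    rw [hco]
    change (ψ y * ψ y) • s y = ∑ i, (ψ y * e.localFrameCoeff 𝓘(ℝ, EM) b i y (s y)) •
      (ψ y • e.localFrame b i y)
    by_cases hy : y ∈ e.baseSet
    · conv_lhs => rw [Bundle.Trivialization.eq_sum_localFrameCoeff_smul (I := 𝓘(ℝ, EM)) (e := e)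
        (b := b) (s := s) hy, Finset.smul_sum]
      refine Finset.sum_congr rfl fun i _ => ?_
      simp only [smul_smul]
      congr 1
      ring
    · have : ψ y = 0 := image_eq_zero_of_notMem_tsupport fun h => hy (hsupp h)
      simp [this]
  have h0 : φ 0 x = 0 := by simpa using hφ.add 0 0 x
  have hφsum : ∀ (S : Finset (Fin (Module.finrank ℝ F))),
      φ (∑ i ∈ S, smulSec (c i) (t i)) x = ∑ i ∈ S, c i x * φ (t i) x := by
    intro S
    induction S using Finset.induction_on with
    | empty => simpa using h0
    | insert a S ha ih => rw [Finset.sum_insert ha, Finset.sum_insert ha, hφ.add, hφ.smul, ih]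
  have h1 : φ (smulSec (ψ * ψ) s) x = φ s x := by
    rw [hφ.smul]
    change ψ x * ψ x * _ = _
    rw [hψ, one_mul, one_mul]
  rw [← h1, hsum, hφsum]
  refine Finset.sum_eq_zero fun i _ => ?_
  change ψ x * e.localFrameCoeff 𝓘(ℝ, EM) b i x (s x) * _ = 0
  rw [hs, map_zero, mul_zero, zero_mul]

theorem IsTensorial.congr {φ : Sec EM F V → M → ℝ} (hφ : IsTensorial φ) {s t : Sec EM F V} {x : M}
    (hst : s x = t x) : φ s x = φ t x := by
  have h : φ (s - t) x = 0 := hφ.eq_zero (by simp [hst])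
  have h' := hφ.add (s - t) t x
  rw [sub_add_cancel, h, zero_add] at h'
  exact h'

/-- The linear functional on the fibre `V x` given by a tensorial expression. -/
def IsTensorial.toDual {φ : Sec EM F V → M → ℝ} (hφ : IsTensorial φ) (x : M) :
    Module.Dual ℝ (V x) where
  toFun v := φ (exists_sec_eq x v).choose x
  map_add' v w := by
    rw [← hφ.add]
    refine hφ.congr ?_
    rw [ContMDiffSection.coe_add, Pi.add_apply]
    simp only [(exists_sec_eq (EM := EM) (F := F) x _).choose_spec]
  map_smul' r v := by
    have h := hφ.smul (ContMDiffMap.const r) (exists_sec_eq x v).choose x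
    change _ = r * _ at h
    rw [RingHom.id_apply, smul_eq_mul, ← h]
    refine hφ.congr ?_
    change _ = r • (exists_sec_eq (EM := EM) (F := F) x v).choose x
    simp only [(exists_sec_eq (EM := EM) (F := F) x _).choose_spec]

theorem IsTensorial.toDual_apply {φ : Sec EM F V → M → ℝ} (hφ : IsTensorial φ) (s : Sec EM F V)
    (x : M) : hφ.toDual x (s x) = φ s x :=
  hφ.congr (exists_sec_eq x (s x)).choose_spec

end Sections

theorem contMDiff_fst_sec {EM : Type*} [NormedAddCommGroup EM] [NormedSpace ℝ EM]
    {M : Type*} [TopologicalSpace M] [ChartedSpace EM M]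
    {F₁ : Type*} [NormedAddCommGroup F₁] [NormedSpace ℝ F₁]
    {V₁ : M → Type*} [∀ x, Zero (V₁ x)] [TopologicalSpace (TotalSpace F₁ V₁)] [∀ x, TopologicalSpace (V₁ x)]
    [FiberBundle F₁ V₁]
    {F₂ : Type*} [NormedAddCommGroup F₂] [NormedSpace ℝ F₂]
    {V₂ : M → Type*} [∀ x, Zero (V₂ x)] [TopologicalSpace (TotalSpace F₂ V₂)] [∀ x, TopologicalSpace (V₂ x)]
    [FiberBundle F₂ V₂] (e : Sec EM (F₁ × F₂) (V₁ ×ᵇ V₂)) :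
    ContMDiff 𝓘(ℝ, EM) (𝓘(ℝ, EM).prod 𝓘(ℝ, F₁)) ∞
      (fun x => TotalSpace.mk' F₁ x (e x).1) := by
  intro x
  have h := e.contMDiff x
  rw [Bundle.contMDiffAt_section] at h ⊢
  exact (contDiff_fst (E := F₁) (F := F₂)).contMDiff.contMDiffAt.comp x h

theorem contMDiff_snd_sec {EM : Type*} [NormedAddCommGroup EM] [NormedSpace ℝ EM]
    {M : Type*} [TopologicalSpace M] [ChartedSpace EM M]
    {F₁ : Type*} [NormedAddCommGroup F₁] [NormedSpace ℝ F₁]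
    {V₁ : M → Type*} [∀ x, Zero (V₁ x)] [TopologicalSpace (TotalSpace F₁ V₁)] [∀ x, TopologicalSpace (V₁ x)]
    [FiberBundle F₁ V₁]
    {F₂ : Type*} [NormedAddCommGroup F₂] [NormedSpace ℝ F₂]
    {V₂ : M → Type*} [∀ x, Zero (V₂ x)] [TopologicalSpace (TotalSpace F₂ V₂)] [∀ x, TopologicalSpace (V₂ x)]
    [FiberBundle F₂ V₂] (e : Sec EM (F₁ × F₂) (V₁ ×ᵇ V₂)) :
    ContMDiff 𝓘(ℝ, EM) (𝓘(ℝ, EM).prod 𝓘(ℝ, F₂)) ∞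
      (fun x => TotalSpace.mk' F₂ x (e x).2) := by
  intro x
  have h := e.contMDiff x
  rw [Bundle.contMDiffAt_section] at h ⊢
  exact (contDiff_snd (E := F₁) (F := F₂)).contMDiff.contMDiffAt.comp x h

/-- The differential at `x` of a function on `M`, so `differentialAt f x v` is the derivative of
`f` along the tangent vector `v`. -/
def differentialAt {EM : Type*} [NormedAddCommGroup EM] [NormedSpace ℝ EM]
    {M : Type*} [TopologicalSpace M] [ChartedSpace EM M] (f : M → ℝ) (x : M) :
    TangentSpace 𝓘(ℝ, EM) x →ₗ[ℝ] ℝ :=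
  (mfderiv 𝓘(ℝ, EM) 𝓘(ℝ, ℝ) f x).toLinearMap

theorem differentialAt_add {EM : Type*} [NormedAddCommGroup EM] [NormedSpace ℝ EM]
    {M : Type*} [TopologicalSpace M] [ChartedSpace EM M] (f g : C^∞⟮𝓘(ℝ, EM), M; ℝ⟯) (x : M)
    (v : TangentSpace 𝓘(ℝ, EM) x) : differentialAt (fun y => f y + g y) x v =
      differentialAt f x v + differentialAt g x v := by
  have hf := (f.contMDiff.mdifferentiable (by simp)) x
  have hg := (g.contMDiff.mdifferentiable (by simp)) x
  exact congrArg (fun T => T v) (hf.hasMFDerivAt.add hg.hasMFDerivAt).mfderiv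

theorem differentialAt_mul {EM : Type*} [NormedAddCommGroup EM] [NormedSpace ℝ EM]
    {M : Type*} [TopologicalSpace M] [ChartedSpace EM M] (f g : C^∞⟮𝓘(ℝ, EM), M; ℝ⟯) (x : M)
    (v : TangentSpace 𝓘(ℝ, EM) x) : differentialAt (fun y => f y * g y) x v =
      f x * differentialAt g x v + g x * differentialAt f x v := by
  have hf := (f.contMDiff.mdifferentiable (by simp)) x
  have hg := (g.contMDiff.mdifferentiable (by simp)) x
  exact congrArg (fun T => T v) (hf.hasMFDerivAt.mul hg.hasMFDerivAt).mfderiv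

theorem finite_fiber {M : Type*} [TopologicalSpace M]
    (F : Type*) [NormedAddCommGroup F] [NormedSpace ℝ F] [FiniteDimensional ℝ F]
    (V : M → Type*) [TopologicalSpace (TotalSpace F V)] [∀ x, TopologicalSpace (V x)]
    [∀ x, AddCommGroup (V x)] [∀ x, Module ℝ (V x)]
    [FiberBundle F V] [VectorBundle ℝ F V] (x : M) : Module.Finite ℝ (V x) :=
  Module.Finite.equiv ((trivializationAt F V x).linearEquivAt ℝ x
    (FiberBundle.mem_baseSet_trivializationAt' x)).symm

theorem t2_fiber {M : Type*} [TopologicalSpace M]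
    (F : Type*) [NormedAddCommGroup F] [NormedSpace ℝ F]
    (V : M → Type*) [TopologicalSpace (TotalSpace F V)] [∀ x, TopologicalSpace (V x)]
    [∀ x, AddCommGroup (V x)] [∀ x, Module ℝ (V x)]
    [FiberBundle F V] [VectorBundle ℝ F V] (x : M) : T2Space (V x) :=
  ((trivializationAt F V x).continuousLinearEquivAt ℝ x
    (FiberBundle.mem_baseSet_trivializationAt' x)).toHomeomorph.isEmbedding.t2Space

/-! ### Bundle maps, Lie algebroids and dual pairs -/

section Algebroids

variable (EM : Type*) [NormedAddCommGroup EM] [NormedSpace ℝ EM]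
  {M : Type*} [TopologicalSpace M] [ChartedSpace EM M]
  (F : Type*) [NormedAddCommGroup F] [NormedSpace ℝ F]
  (V : M → Type*) [TopologicalSpace (TotalSpace F V)] [∀ x, TopologicalSpace (V x)]
  [∀ x, AddCommGroup (V x)] [∀ x, Module ℝ (V x)]
  [FiberBundle F V]
  (F' : Type*) [NormedAddCommGroup F'] [NormedSpace ℝ F']
  (W : M → Type*) [TopologicalSpace (TotalSpace F' W)] [∀ x, TopologicalSpace (W x)]
  [∀ x, AddCommGroup (W x)] [∀ x, Module ℝ (W x)]
  [FiberBundle F' W]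

/-- A smooth vector bundle map `V → W` over the identity of `M`. -/
structure BundleMap where
  /-- the linear maps between the fibres -/
  toFun : ∀ x, V x →ₗ[ℝ] W x
  contMDiff : ContMDiff (𝓘(ℝ, EM).prod 𝓘(ℝ, F)) (𝓘(ℝ, EM).prod 𝓘(ℝ, F')) ∞
    (fun v : TotalSpace F V => TotalSpace.mk' F' v.1 (toFun v.1 v.2))

variable [VectorBundle ℝ F V]

/-- A Lie algebroid structure on the vector bundle `V` over `M`: a Lie bracket on `Γ(V)` and an
anchor `V → TM`, which induces a Lie algebra homomorphism into the vector fields and satisfies the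
Leibniz rule. -/
structure LieAlgebroid [IsManifold 𝓘(ℝ, EM) ∞ M] where
  /-- the bracket of sections -/
  bracket : Sec EM F V →ₗ[ℝ] Sec EM F V →ₗ[ℝ] Sec EM F V
  /-- the anchor -/
  anchor : BundleMap EM F V EM (TangentSpace 𝓘(ℝ, EM) : M → Type _)
  bracket_self : ∀ X, bracket X X = 0
  jacobi : ∀ X Y Z,
    bracket (bracket X Y) Z + bracket (bracket Y Z) X + bracket (bracket Z X) Y = 0
  leibniz : ∀ (X Y : Sec EM F V) (f : C^∞⟮𝓘(ℝ, EM), M; ℝ⟯) (x : M),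
    bracket X (smulSec f Y) x = f x • bracket X Y x +
      differentialAt f x (anchor.toFun x (X x)) • Y x
  anchor_bracket : ∀ (X Y : Sec EM F V) (x : M), anchor.toFun x (bracket X Y x) =
    VectorField.mlieBracket 𝓘(ℝ, EM) (fun y => anchor.toFun y (X y))
      (fun y => anchor.toFun y (Y y)) x

/-- A smooth fibrewise perfect pairing of `W` with `V`, i.e. an identification of the vector
bundle `W` with `V*`. -/
structure DualPair where
  /-- the identification of `W x` with the dual of `V x` -/
  toEquiv : ∀ x, W x ≃ₗ[ℝ] Module.Dual ℝ (V x)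
  contMDiff : ∀ (w : Sec EM F' W) (v : Sec EM F V),
    ContMDiff 𝓘(ℝ, EM) 𝓘(ℝ, ℝ) ∞ fun x => toEquiv x (w x) (v x)

variable {EM F V F' W}

/-- The pairing `⟨w, v⟩` of vectors in the fibres over `x`. -/
def DualPair.pair (D : DualPair EM F V F' W) {x : M} (w : W x) (v : V x) : ℝ := D.toEquiv x w v

/-- `⟨w, v⟩` as a smooth function. -/
def DualPair.pairSec (D : DualPair EM F V F' W) (w : Sec EM F' W) (v : Sec EM F V) :
    C^∞⟮𝓘(ℝ, EM), M; ℝ⟯ :=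
  ⟨fun x => D.pair (w x) (v x), D.contMDiff w v⟩

variable (EM F V) in
/-- The pairing of `V*` with `V` by evaluation. -/
def dualPair [FiniteDimensional ℝ F]
    [∀ x, IsTopologicalAddGroup (V x)] [∀ x, ContinuousSMul ℝ (V x)] :
    DualPair EM F V (F →L[ℝ] ℝ) (DualBundle V) where
  toEquiv x :=
    haveI := finite_fiber F V x
    haveI := t2_fiber F V x
    (LinearMap.toContinuousLinearMap : (V x →ₗ[ℝ] ℝ) ≃ₗ[ℝ] (V x →L[ℝ] ℝ)).symm
  contMDiff w v := by
    have := ContMDiff.clm_bundle_apply (F₂ := ℝ) (E₂ := Bundle.Trivial M ℝ) w.contMDiff v.contMDiff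
    intro x
    exact (Bundle.contMDiffAt_section x).1 (this x)

/-- The same pairing, read as a pairing of `V` with `W`. -/
def DualPair.flip [FiniteDimensional ℝ F] (D : DualPair EM F V F' W) : DualPair EM F' W F V where
  toEquiv x :=
    haveI := finite_fiber F V x
    (Module.evalEquiv ℝ (V x)).trans (D.toEquiv x).dualMap
  contMDiff v w := D.contMDiff w v

theorem dualPair_pair [FiniteDimensional ℝ F]
    [∀ x, IsTopologicalAddGroup (V x)] [∀ x, ContinuousSMul ℝ (V x)] {x : M}
    (w : DualBundle V x) (v : V x) : (dualPair EM F V).pair w v = w v := rfl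

theorem DualPair.flip_pair [FiniteDimensional ℝ F] (D : DualPair EM F V F' W) {x : M}
    (v : V x) (w : W x) : D.flip.pair v w = D.pair w v := rfl

end Algebroids

/-! ### Calculus of a Lie algebroid

Here `L` is a Lie algebroid structure on `V` and `D` identifies `W` with `V*`. -/

section Calculus

variable {EM : Type*} [NormedAddCommGroup EM] [NormedSpace ℝ EM]
  {M : Type*} [TopologicalSpace M] [ChartedSpace EM M] [IsManifold 𝓘(ℝ, EM) ∞ M]
  {F : Type*} [NormedAddCommGroup F] [NormedSpace ℝ F]
  {V : M → Type*} [TopologicalSpace (TotalSpace F V)] [∀ x, TopologicalSpace (V x)]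
  [∀ x, AddCommGroup (V x)] [∀ x, Module ℝ (V x)]
  [FiberBundle F V] [VectorBundle ℝ F V]
  {F' : Type*} [NormedAddCommGroup F'] [NormedSpace ℝ F']
  {W : M → Type*} [TopologicalSpace (TotalSpace F' W)] [∀ x, TopologicalSpace (W x)]
  [∀ x, AddCommGroup (W x)] [∀ x, Module ℝ (W x)]
  [FiberBundle F' W]

namespace LieAlgebroid

/-- The action `a(X) f` of a section of a Lie algebroid on a function. -/
def act (L : LieAlgebroid EM F V) (X : Sec EM F V) (f : M → ℝ) : M → ℝ :=
  fun x => differentialAt f x (L.anchor.toFun x (X x))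

/-- The expression `a(X)⟨w, Y⟩ - ⟨w, [X, Y]⟩`, which is `⟨L_X w, Y⟩`. -/
def lieDerPair (L : LieAlgebroid EM F V) (D : DualPair EM F V F' W) (X : Sec EM F V)
    (w : Sec EM F' W) (Y : Sec EM F V) : M → ℝ :=
  fun x => L.act X (D.pairSec w Y) x - D.pair (w x) (L.bracket X Y x)

theorem isTensorial_lieDerPair (L : LieAlgebroid EM F V) (D : DualPair EM F V F' W)
    (X : Sec EM F V) (w : Sec EM F' W) : IsTensorial (L.lieDerPair D X w) where
  add s t x := by
    have h : (D.pairSec w (s + t) : M → ℝ) = fun y => D.pairSec w s y + D.pairSec w t y :=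
      funext fun y => map_add (D.toEquiv y (w y)) (s y) (t y)
    have h' : D.pair (w x) (L.bracket X (s + t) x)
        = D.pair (w x) (L.bracket X s x) + D.pair (w x) (L.bracket X t x) := by
      rw [map_add]
      exact map_add (D.toEquiv x (w x)) _ _
    simp only [lieDerPair, act]
    rw [h, h', differentialAt_add]
    ring
  smul f s x := by
    have h : (D.pairSec w (smulSec f s) : M → ℝ) = fun y => f y * D.pairSec w s y :=
      funext fun y => map_smul (D.toEquiv y (w y)) (f y) (s y)
    have h' : D.pair (w x) (L.bracket X (smulSec f s) x)
        = f x * D.pair (w x) (L.bracket X s x)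
          + differentialAt f x (L.anchor.toFun x (X x)) * D.pairSec w s x := by
      rw [L.leibniz]
      change D.toEquiv x (w x) _ = _
      rw [map_add, map_smul, map_smul]
      rfl
    simp only [lieDerPair, act]
    rw [h, h', differentialAt_mul]
    ring

variable [FiniteDimensional ℝ EM] [T2Space M] [FiniteDimensional ℝ F]
  [ContMDiffVectorBundle ∞ F V 𝓘(ℝ, EM)]

/-- The Lie derivative `L_X w` of a section of `V*`, as a section of `V*`. -/
def lieDer (L : LieAlgebroid EM F V) (D : DualPair EM F V F' W) (X : Sec EM F V)
    (w : Sec EM F' W) (x : M) : W x :=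
  (D.toEquiv x).symm ((L.isTensorial_lieDerPair D X w).toDual x)

theorem pair_lieDer (L : LieAlgebroid EM F V) (D : DualPair EM F V F' W) (X : Sec EM F V)
    (w : Sec EM F' W) (Y : Sec EM F V) (x : M) :
    D.pair (L.lieDer D X w x) (Y x) =
      L.act X (D.pairSec w Y) x - D.pair (w x) (L.bracket X Y x) := by
  rw [DualPair.pair, lieDer, LinearEquiv.apply_symm_apply, IsTensorial.toDual_apply, lieDerPair]

/-- The differential of a function, as a section of `V*`: `⟨df, X⟩ = a(X) f`. -/
def grad (L : LieAlgebroid EM F V) (D : DualPair EM F V F' W) (f : M → ℝ) (x : M) : W x :=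
  (D.toEquiv x).symm (differentialAt f x ∘ₗ L.anchor.toFun x)

end LieAlgebroid

end Calculus

/-! ### Exterior calculus

With `D` identifying `W` with `V*`, the `k`-forms of `V` are the sections of `∧ᵏV*` and are
evaluated on `k` sections of `V`; the `k`-vectors of `V` are the sections of `∧ᵏV` and, being the
`k`-forms of `W`, are evaluated on `k` sections of `W`. -/

section Exterior

variable (EM : Type*) [NormedAddCommGroup EM] [NormedSpace ℝ EM]
  {M : Type*} [TopologicalSpace M] [ChartedSpace EM M]
  (F : Type*) [NormedAddCommGroup F] [NormedSpace ℝ F]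
  (V : M → Type*) [TopologicalSpace (TotalSpace F V)] [∀ x, TopologicalSpace (V x)]
  [∀ x, AddCommGroup (V x)] [∀ x, Module ℝ (V x)]
  [FiberBundle F V] [VectorBundle ℝ F V]
  (F' : Type*) [NormedAddCommGroup F'] [NormedSpace ℝ F']
  (W : M → Type*) [TopologicalSpace (TotalSpace F' W)] [∀ x, TopologicalSpace (W x)]
  [∀ x, AddCommGroup (W x)] [∀ x, Module ℝ (W x)]
  [FiberBundle F' W] [VectorBundle ℝ F' W]

/-- Function-valued expressions in `k` sections of `V`. -/
abbrev Cochain (k : ℕ) := (Fin k → Sec EM F V) → M → ℝ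

/-- A smooth section of `∧ᵏV*`, i.e. a `k`-form of `V`. -/
structure AltSec (k : ℕ) where
  /-- the alternating form on the fibre over `x` -/
  toFun : ∀ x, V x [⋀^Fin k]→ₗ[ℝ] ℝ
  contMDiff : ∀ s : Fin k → Sec EM F V,
    ContMDiff 𝓘(ℝ, EM) 𝓘(ℝ, ℝ) ∞ fun x => toFun x fun i => s i x

variable {EM F V F' W}

/-- A `k`-form evaluated on sections. -/
def AltSec.cochain {k : ℕ} (P : AltSec EM F V k) : Cochain EM F V k :=
  fun s x => P.toFun x fun i => s i x

/-- The differential of the forms of a Lie algebroid: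
`(dP)(X₀,…,Xₖ) = ∑ᵢ (-1)ⁱ a(Xᵢ) P(X₀,…,X̂ᵢ,…,Xₖ) + ∑_{i<j} (-1)ⁱ⁺ʲ P([Xᵢ,Xⱼ],X₀,…,X̂ᵢ,…,X̂ⱼ,…,Xₖ)`.
In the second sum, `[Xᵢ,Xⱼ]` is put at the place of `Xⱼ`, which for alternating `P` changes the
sign `(-1)ⁱ⁺ʲ` into `(-1)ⁱ⁺¹`; and `j` is counted after the removal of `Xᵢ`. -/
def LieAlgebroid.differential [IsManifold 𝓘(ℝ, EM) ∞ M] (L : LieAlgebroid EM F V) {k : ℕ}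
    (P : Cochain EM F V k) : Cochain EM F V (k + 1) := fun X x =>
  (∑ i : Fin (k + 1), (-1) ^ (i : ℕ) * L.act (X i) (P (i.removeNth X)) x) +
  ∑ i : Fin (k + 1), ∑ j : Fin k, if (i : ℕ) ≤ j then
    (-1) ^ ((i : ℕ) + 1) *
      P (Function.update (i.removeNth X) j (L.bracket (X i) (X (i.succAbove j)))) x
  else 0

/-- The wedge product `X₁ ∧ ⋯ ∧ Xₙ` of a list of sections of `V`, as an `n`-vector:
`(X₁ ∧ ⋯ ∧ Xₙ)(w₁,…,wₙ) = det ⟨wᵢ, Xⱼ⟩`. It is zero in every degree other than the length. -/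
def DualPair.wedge (D : DualPair EM F V F' W) (X : List (Sec EM F V)) {n : ℕ} :
    Cochain EM F' W n := fun w x =>
  if h : n = X.length then
    Matrix.det (Matrix.of fun i j : Fin n => D.pair (w i x) (X.get (j.cast h) x))
  else 0

/-- The Schouten bracket of `f X₁ ∧ ⋯ ∧ X_p` and `g Y₁ ∧ ⋯ ∧ Y_q`, in degree `n = p + q - 1`. This
is what the rules `[X, Y]` for sections, `[X, f] = a(X) f`, `[f, g] = 0`,
`[P, Q] = -(-1)^((p-1)(q-1)) [Q, P]` and `[P, Q ∧ R] = [P, Q] ∧ R + (-1)^((p-1)q) Q ∧ [P, R]` give: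
`f g ∑_{i,j} (-1)ⁱ⁺ʲ [Xᵢ, Yⱼ] ∧ X₁ ∧ ⋯ X̂ᵢ ⋯ ∧ X_p ∧ Y₁ ∧ ⋯ Ŷⱼ ⋯ ∧ Y_q`
`+ f ∑ᵢ (-1)^(p-i) (a(Xᵢ) g) X₁ ∧ ⋯ X̂ᵢ ⋯ ∧ X_p ∧ Y₁ ∧ ⋯ ∧ Y_q`
`+ g ∑ⱼ (-1)ʲ (a(Yⱼ) f) X₁ ∧ ⋯ ∧ X_p ∧ Y₁ ∧ ⋯ Ŷⱼ ⋯ ∧ Y_q` (in the code, indices start at `0`). -/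
def LieAlgebroid.schoutenTerm [IsManifold 𝓘(ℝ, EM) ∞ M] (L : LieAlgebroid EM F V)
    (D : DualPair EM F V F' W) {p q n : ℕ}
    (f : C^∞⟮𝓘(ℝ, EM), M; ℝ⟯) (X : Fin p → Sec EM F V)
    (g : C^∞⟮𝓘(ℝ, EM), M; ℝ⟯) (Y : Fin q → Sec EM F V) : Cochain EM F' W n := fun w x =>
  f x * g x * (∑ i : Fin p, ∑ j : Fin q, (-1) ^ ((i : ℕ) + j) *
    D.wedge (L.bracket (X i) (Y j) ::
      ((List.ofFn X).eraseIdx i ++ (List.ofFn Y).eraseIdx j)) w x) +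
  f x * (∑ i : Fin p, (-1) ^ (p + (i : ℕ) + 1) * L.act (X i) g x *
    D.wedge ((List.ofFn X).eraseIdx i ++ List.ofFn Y) w x) +
  g x * (∑ j : Fin q, (-1) ^ ((j : ℕ) + 1) * L.act (Y j) f x *
    D.wedge (List.ofFn X ++ (List.ofFn Y).eraseIdx j) w x)

/-- An expression of the `p`-vector `P` near `x` as a finite sum of terms `f X₁ ∧ ⋯ ∧ X_p`. -/
structure Decomposition (D : DualPair EM F V F' W) {p : ℕ} (P : Cochain EM F' W p) (x : M) where
  /-- the number of terms -/
  size : ℕ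
  /-- the coefficients `f` -/
  coeff : Fin size → C^∞⟮𝓘(ℝ, EM), M; ℝ⟯
  /-- the factors `X₁, …, X_p` -/
  factor : Fin size → Fin p → Sec EM F V
  eventually_eq : ∀ᶠ y in 𝓝 x, ∀ w,
    P w y = ∑ α, coeff α y * D.wedge (List.ofFn (factor α)) w y

open Classical in
/-- The Schouten bracket of a `p`-vector and a `q`-vector of a Lie algebroid, in degree
`n = p + q - 1`: the local and biadditive extension of the bracket of decomposable multivectors.
Around each point, every multivector is a finite sum of decomposable ones, and the value does not
depend on the choice of these sums. -/
def LieAlgebroid.schouten [IsManifold 𝓘(ℝ, EM) ∞ M] (L : LieAlgebroid EM F V)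
    (D : DualPair EM F V F' W) {p q n : ℕ} (P : Cochain EM F' W p) (Q : Cochain EM F' W q) :
    Cochain EM F' W n := fun w x =>
  if h : Nonempty (Decomposition D P x) ∧ Nonempty (Decomposition D Q x) then
    ∑ α, ∑ β, L.schoutenTerm D (h.1.some.coeff α) (h.1.some.factor α)
      (h.2.some.coeff β) (h.2.some.factor β) w x
  else 0

/-- A bundle map `H : W → V`, where `W` is the dual of `V`, is skew-symmetric if
`⟨w₁, H w₂⟩ = -⟨w₂, H w₁⟩`. -/
def BundleMap.IsSkew (D : DualPair EM F V F' W) (H : BundleMap EM F' W F V) : Prop :=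
  ∀ (x : M) (w₁ w₂ : W x), D.pair w₁ (H.toFun x w₂) = -D.pair w₂ (H.toFun x w₁)

/-- A skew-symmetric bundle map `H : W → V` as a section of `∧²V`: `H(w₁, w₂) = ⟨w₂, H w₁⟩`. -/
def BundleMap.toBivector (D : DualPair EM F V F' W) (H : BundleMap EM F' W F V)
    (hH : H.IsSkew D) : AltSec EM F' W 2 where
  toFun x :=
    { toFun := fun w => D.pair (w 1) (H.toFun x (w 0))
      map_update_add' := by
        intro _ w i a b
        obtain rfl : ‹DecidableEq (Fin 2)› = instDecidableEqFin 2 := Subsingleton.elim _ _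
        fin_cases i <;> simp [DualPair.pair]
      map_update_smul' := by
        intro _ w i c a
        obtain rfl : ‹DecidableEq (Fin 2)› = instDecidableEqFin 2 := Subsingleton.elim _ _
        fin_cases i <;> simp [DualPair.pair]
      map_eq_zero_of_eq' := by
        intro w i j hij hne
        have h01 : w 0 = w 1 := by
          fin_cases i <;> fin_cases j <;> simp_all
        have h := hH x (w 0) (w 0)
        rw [← h01]
        linarith }
  contMDiff s := D.contMDiff (s 1) ⟨fun x => H.toFun x (s 0 x), H.contMDiff.comp (s 0).contMDiff⟩

end Exterior

/-! ### Lie bialgebroids and Dirac subbundles of the double -/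

section Double

variable (EM : Type*) [NormedAddCommGroup EM] [NormedSpace ℝ EM]
  {M : Type*} [TopologicalSpace M] [ChartedSpace EM M]

/-- A family of subspaces of the fibres is a smooth subbundle if it is locally spanned by a
smooth frame. -/
def IsSubbundle (F : Type*) [NormedAddCommGroup F] [NormedSpace ℝ F]
    (V : M → Type*) [TopologicalSpace (TotalSpace F V)] [∀ x, TopologicalSpace (V x)]
    [∀ x, AddCommGroup (V x)] [∀ x, Module ℝ (V x)] [FiberBundle F V]
    (L : ∀ x, Submodule ℝ (V x)) : Prop :=
  ∀ x, ∃ u : Set M, IsOpen u ∧ x ∈ u ∧ ∃ (k : ℕ) (s : Fin k → ∀ y, V y),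
    (∀ i, ContMDiffOn 𝓘(ℝ, EM) (𝓘(ℝ, EM).prod 𝓘(ℝ, F)) ∞ (fun y => TotalSpace.mk' F y (s i y)) u) ∧
    ∀ y ∈ u, LinearIndependent ℝ (fun i => s i y) ∧ Submodule.span ℝ (Set.range fun i => s i y) = L y

variable [FiniteDimensional ℝ EM] [T2Space M] [IsManifold 𝓘(ℝ, EM) ∞ M]
  (F : Type*) [NormedAddCommGroup F] [NormedSpace ℝ F] [FiniteDimensional ℝ F]
  (A : M → Type*) [TopologicalSpace (TotalSpace F A)] [∀ x, TopologicalSpace (A x)]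
  [∀ x, AddCommGroup (A x)] [∀ x, Module ℝ (A x)]
  [∀ x, IsTopologicalAddGroup (A x)] [∀ x, ContinuousSMul ℝ (A x)]
  [FiberBundle F A] [VectorBundle ℝ F A] [ContMDiffVectorBundle ∞ F A 𝓘(ℝ, EM)]

/-- A Lie bialgebroid `(A, A*)`: Lie algebroid structures on `A` and `A*` such that the differential
`d_*` on the sections of `∧A` given by the structure of `A*` is a derivation of the Schouten bracket
given by the structure of `A`, i.e. `d_*[P, Q] = [d_*P, Q] + (-1)^(p-1) [P, d_*Q]` for all
`P ∈ Γ(∧ᵖA)` and `Q ∈ Γ(∧^q A)`. -/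
structure LieBialgebroid where
  /-- the Lie algebroid structure of `A` -/
  alg : LieAlgebroid EM F A
  /-- the Lie algebroid structure of `A*` -/
  dual : LieAlgebroid EM (F →L[ℝ] ℝ) (DualBundle A)
  derivation : ∀ (p q n : ℕ), n + 1 = p + q →
    ∀ (P : AltSec EM (F →L[ℝ] ℝ) (DualBundle A) p) (Q : AltSec EM (F →L[ℝ] ℝ) (DualBundle A) q),
    dual.differential (alg.schouten (n := n) (dualPair EM F A) P.cochain Q.cochain) =
      alg.schouten (dualPair EM F A) (dual.differential P.cochain) Q.cochain +
      (-1 : ℝ) ^ (p + 1) •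
        alg.schouten (dualPair EM F A) P.cochain (dual.differential Q.cochain)
  /-- the same for two functions, whose bracket is zero -/
  derivation_zero :
    ∀ P Q : AltSec EM (F →L[ℝ] ℝ) (DualBundle A) 0,
    0 = alg.schouten (n := 0) (dualPair EM F A) (dual.differential P.cochain) Q.cochain -
      alg.schouten (dualPair EM F A) P.cochain (dual.differential Q.cochain)

variable {EM F A}

/-- The component in `Γ(A)` of a section of `A ⊕ A*`. -/
def secFst (e : Sec EM (F × (F →L[ℝ] ℝ)) (A ×ᵇ DualBundle A)) : Sec EM F A :=
  ⟨fun x => (e x).1, contMDiff_fst_sec e⟩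

/-- The component in `Γ(A*)` of a section of `A ⊕ A*`. -/
def secSnd (e : Sec EM (F × (F →L[ℝ] ℝ)) (A ×ᵇ DualBundle A)) :
    Sec EM (F →L[ℝ] ℝ) (DualBundle A) :=
  ⟨fun x => (e x).2, contMDiff_snd_sec e⟩

/-- The symmetric pairing `(X₁ + ξ₁, X₂ + ξ₂)₊ = ½ (⟨ξ₁, X₂⟩ + ⟨ξ₂, X₁⟩)` on a fibre of `A ⊕ A*`. -/
def pairingPlus {x : M} (u v : (A ×ᵇ DualBundle A) x) : ℝ :=
  1 / 2 * ((dualPair EM F A).pair u.2 v.1 + (dualPair EM F A).pair v.2 u.1)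

/-- The function `(e₁, e₂)₋ = ½ (⟨ξ₁, X₂⟩ - ⟨ξ₂, X₁⟩)` for sections of `A ⊕ A*`. -/
def pairingMinus (e₁ e₂ : Sec EM (F × (F →L[ℝ] ℝ)) (A ×ᵇ DualBundle A)) : M → ℝ := fun x =>
  1 / 2 * ((dualPair EM F A).pair (e₁ x).2 (e₂ x).1 - (dualPair EM F A).pair (e₂ x).2 (e₁ x).1)

namespace LieBialgebroid

variable (B : LieBialgebroid EM F A)

/-- The bracket of two sections `eᵢ = Xᵢ + ξᵢ` of the double `A ⊕ A*`, as a section of `A ⊕ A*`: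
`[e₁, e₂] = ([X₁, X₂] + L_{ξ₁} X₂ - L_{ξ₂} X₁ - d_*(e₁, e₂)₋)`
`+ ([ξ₁, ξ₂] + L_{X₁} ξ₂ - L_{X₂} ξ₁ + d(e₁, e₂)₋)`. -/
def doubleBracket (e₁ e₂ : Sec EM (F × (F →L[ℝ] ℝ)) (A ×ᵇ DualBundle A)) (x : M) :
    (A ×ᵇ DualBundle A) x :=
  let D := dualPair EM F A
  (B.alg.bracket (secFst e₁) (secFst e₂) x
      + B.dual.lieDer D.flip (secSnd e₁) (secFst e₂) x
      - B.dual.lieDer D.flip (secSnd e₂) (secFst e₁) x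
      - B.dual.grad D.flip (pairingMinus e₁ e₂) x,
    B.dual.bracket (secSnd e₁) (secSnd e₂) x
      + B.alg.lieDer D (secFst e₁) (secSnd e₂) x
      - B.alg.lieDer D (secFst e₂) (secSnd e₁) x
      + B.alg.grad D (pairingMinus e₁ e₂) x)

/-- Dirac subbundles of the double `A ⊕ A*`: the smooth subbundles which are maximally isotropic for
`( , )₊` and whose sections are closed under the bracket. -/
structure IsDirac (L : ∀ x, Submodule ℝ ((A ×ᵇ DualBundle A) x)) : Prop where
  subbundle : IsSubbundle EM (F × (F →L[ℝ] ℝ)) (A ×ᵇ DualBundle A) L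
  maximal_isotropic : ∀ x, Maximal
    (fun S : Submodule ℝ ((A ×ᵇ DualBundle A) x) =>
      ∀ u ∈ S, ∀ v ∈ S, pairingPlus (EM := EM) (F := F) u v = 0) (L x)
  integrable : ∀ e₁ e₂ : Sec EM (F × (F →L[ℝ] ℝ)) (A ×ᵇ DualBundle A),
    (∀ x, e₁ x ∈ L x) → (∀ x, e₂ x ∈ L x) → ∀ x, B.doubleBracket e₁ e₂ x ∈ L x

end LieBialgebroid

/-- The graph `{Hξ + ξ | ξ ∈ A*}` of a bundle map `H : A* → A`. -/
def graphOfDual (H : BundleMap EM (F →L[ℝ] ℝ) (DualBundle A) F A) (x : M) :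
    Submodule ℝ ((A ×ᵇ DualBundle A) x) :=
  LinearMap.range ((H.toFun x).prod LinearMap.id)

/-- The graph `{X + IX | X ∈ A}` of a bundle map `I : A → A*`. -/
def graph (I : BundleMap EM F A (F →L[ℝ] ℝ) (DualBundle A)) (x : M) :
    Submodule ℝ ((A ×ᵇ DualBundle A) x) :=
  LinearMap.range (LinearMap.id.prod (I.toFun x))

end Double

end

end Algebroid

/-! Let `H : W → V` be a bundle map, with `W` identified with `V*`. Isotropy of the graph is
skew-symmetry of `H`. Maximality then comes for free: a vector `X + ξ` orthogonal to all `Hw + w`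
satisfies `⟨w, X⟩ = -⟨ξ, Hw⟩ = ⟨w, Hξ⟩` for all `w`, so it lies in the graph. The graph is a smooth
subbundle because it is the image of an injective bundle map. What remains is integrability.

For skew `H`, the bracket of `Hu + u` and `Hv + v` has components `graphBracketBase` in `V` and
`graphBracketDual` in `W`, and it lies in the graph iff the first is the image of the second under
`H`. The defect is measured by pairing with a third section `w`. By skewness, `-⟨w, H ζ⟩ = ⟨ζ, Hw⟩`,
so every Lie derivative and gradient can be evaluated by its definition. The terms from the
structure of `W` add up to `(d_*H)(u, v, w)`; those from the structure of `V` add up to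
`halfBracket` (`pair_graphBracket`).

It has to be shown that `halfBracket` is `½[H, H]`, although the Schouten bracket is given through
decomposable multivectors. For `f X₀ ∧ X₁` and `g Y₀ ∧ Y₁` with associated maps `S`, `T`, the
Schouten bracket is `halfBracket S T + halfBracket T S`, by the Leibniz rule and a polynomial
identity (`schoutenTerm_eq_halfBracket`). Since `halfBracket` is biadditive and local, summing over
any local decomposition of `H` gives `2 halfBracket H H`, whichever decomposition was chosen
(`schouten_self_eq_halfBracket`). Decompositions exist by means of local dual frames.

Everything up to here is symmetric in the two bundles, so the statement on `I : A → A*` is the same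
argument with the pairing flipped; the only change is a sign of `(e₁, e₂)₋`, which matches the
opposite signs of `d_*` and `d` in the double bracket. -/

namespace Algebroid

noncomputable section

section Calculus

variable {EM : Type*} [NormedAddCommGroup EM] [NormedSpace ℝ EM]
  {M : Type*} [TopologicalSpace M] [ChartedSpace EM M]
  {F : Type*} [NormedAddCommGroup F] [NormedSpace ℝ F]
  {V : M → Type*} [TopologicalSpace (TotalSpace F V)] [∀ x, TopologicalSpace (V x)]
  [∀ x, AddCommGroup (V x)] [∀ x, Module ℝ (V x)]
  [FiberBundle F V]
  {F' : Type*} [NormedAddCommGroup F'] [NormedSpace ℝ F']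
  {W : M → Type*} [TopologicalSpace (TotalSpace F' W)] [∀ x, TopologicalSpace (W x)]
  [∀ x, AddCommGroup (W x)] [∀ x, Module ℝ (W x)]
  [FiberBundle F' W]

/-! ### Pairings and sections -/

namespace DualPair

theorem pair_add_left (D : DualPair EM F V F' W) {x : M} (w w' : W x) (v : V x) :
    D.pair (w + w') v = D.pair w v + D.pair w' v := by simp [pair]

theorem pair_sub_left (D : DualPair EM F V F' W) {x : M} (w w' : W x) (v : V x) :
    D.pair (w - w') v = D.pair w v - D.pair w' v := by simp [pair]

theorem pair_smul_left (D : DualPair EM F V F' W) {x : M} (c : ℝ) (w : W x) (v : V x) :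
    D.pair (c • w) v = c * D.pair w v := by simp [pair]

theorem pair_add_right (D : DualPair EM F V F' W) {x : M} (w : W x) (v v' : V x) :
    D.pair w (v + v') = D.pair w v + D.pair w v' := by simp [pair]

theorem pair_sub_right (D : DualPair EM F V F' W) {x : M} (w : W x) (v v' : V x) :
    D.pair w (v - v') = D.pair w v - D.pair w v' := by simp [pair]

theorem pair_smul_right (D : DualPair EM F V F' W) {x : M} (c : ℝ) (w : W x) (v : V x) :
    D.pair w (c • v) = c * D.pair w v := by simp [pair]

theorem pair_sum_left (D : DualPair EM F V F' W) {x : M} {ι : Type*} (S : Finset ι)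
    (w : ι → W x) (v : V x) : D.pair (∑ i ∈ S, w i) v = ∑ i ∈ S, D.pair (w i) v := by
  simp [pair]

theorem pair_sum_right (D : DualPair EM F V F' W) {x : M} {ι : Type*} (S : Finset ι)
    (w : W x) (v : ι → V x) : D.pair w (∑ i ∈ S, v i) = ∑ i ∈ S, D.pair w (v i) := by
  simp [pair]

theorem eq_of_pair_left (D : DualPair EM F V F' W) {x : M} {w w' : W x}
    (h : ∀ v : V x, D.pair w v = D.pair w' v) : w = w' :=
  (D.toEquiv x).injective (LinearMap.ext h)

theorem eq_of_pair_right (D : DualPair EM F V F' W) {x : M} {v v' : V x}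
    (h : ∀ w : W x, D.pair w v = D.pair w v') : v = v' := by
  refine (Module.forall_dual_apply_eq_zero_iff ℝ (v - v')).1 (fun φ => ?_) |> sub_eq_zero.1
  obtain ⟨w, rfl⟩ := (D.toEquiv x).surjective φ
  have := h w
  rw [← sub_eq_zero, ← pair_sub_right] at this
  exact this

end DualPair

/-- The image of a smooth section under a smooth bundle map. -/
def BundleMap.mapSec (H : BundleMap EM F' W F V) (w : Sec EM F' W) : Sec EM F V :=
  ⟨fun x => H.toFun x (w x), H.contMDiff.comp w.contMDiff⟩

theorem BundleMap.mapSec_apply (H : BundleMap EM F' W F V) (w : Sec EM F' W) (x : M) :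
    H.mapSec w x = H.toFun x (w x) := rfl

variable [VectorBundle ℝ F V]

theorem smulSec_apply (f : C^∞⟮𝓘(ℝ, EM), M; ℝ⟯) (s : Sec EM F V) (x : M) :
    smulSec f s x = f x • s x := rfl

theorem sum_sec_apply {ι : Type*} (S : Finset ι) (s : ι → Sec EM F V) (x : M) :
    (∑ i ∈ S, s i) x = ∑ i ∈ S, s i x := by
  rw [← ContMDiffSection.coeAddHom_apply, map_sum, Finset.sum_apply]
  rfl

/-! ### Derivatives of functions -/

theorem differentialAt_congr {f g : M → ℝ} {x : M} (h : f =ᶠ[𝓝 x] g) :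
    differentialAt (EM := EM) f x = differentialAt g x := by
  rw [differentialAt, h.mfderiv_eq]
  rfl

theorem differentialAt_neg (f : M → ℝ) (x : M) (v : TangentSpace 𝓘(ℝ, EM) x) :
    differentialAt (fun y => -f y) x v = -differentialAt f x v := by
  have := mfderiv_neg (I := 𝓘(ℝ, EM)) (f := f) (x := x)
  exact congrArg (fun T => T v) this

theorem differentialAt_const (c : ℝ) (x : M) (v : TangentSpace 𝓘(ℝ, EM) x) :
    differentialAt (fun _ : M => c) x v = 0 := by
  rw [differentialAt, mfderiv_const]
  rfl

theorem differentialAt_sub (f g : C^∞⟮𝓘(ℝ, EM), M; ℝ⟯) (x : M)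
    (v : TangentSpace 𝓘(ℝ, EM) x) : differentialAt (fun y => f y - g y) x v =
      differentialAt f x v - differentialAt g x v := by
  have h := differentialAt_add f (-g) x v
  have h' : differentialAt (-g : C^∞⟮𝓘(ℝ, EM), M; ℝ⟯) x v = -differentialAt g x v :=
    differentialAt_neg _ _ _
  rw [h', ← sub_eq_add_neg] at h
  rw [← h]
  exact congrArg (fun k => differentialAt k x v) (funext fun y => sub_eq_add_neg _ _)

theorem differentialAt_sum {ι : Type*} (S : Finset ι) (f : ι → C^∞⟮𝓘(ℝ, EM), M; ℝ⟯) (x : M)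
    (v : TangentSpace 𝓘(ℝ, EM) x) : differentialAt (fun y => ∑ i ∈ S, f i y) x v =
      ∑ i ∈ S, differentialAt (f i) x v := by
  classical
  induction S using Finset.induction_on with
  | empty => simpa using differentialAt_const 0 x v
  | insert a S ha ih =>
    rw [Finset.sum_insert ha, ← ih]
    have h : (fun y => ∑ i ∈ S, f i y) = (∑ i ∈ S, f i : C^∞⟮𝓘(ℝ, EM), M; ℝ⟯) := by
      funext y
      rw [← ContMDiffMap.coeFnAddMonoidHom_apply, map_sum, Finset.sum_apply]
      rfl
    rw [h, ← differentialAt_add, ← h]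
    congr 2
    funext y
    rw [Finset.sum_insert ha]

/-! ### Locality of the bracket -/

namespace LieAlgebroid

variable [IsManifold 𝓘(ℝ, EM) ∞ M] (L : LieAlgebroid EM F V)

theorem bracket_skew (X Y : Sec EM F V) : L.bracket X Y = -L.bracket Y X := by
  have h := L.bracket_self (X + Y)
  simp only [map_add, LinearMap.add_apply, L.bracket_self, zero_add, add_zero] at h
  exact eq_neg_of_add_eq_zero_left (by rw [add_comm]; exact h)

theorem leibniz_left (X Y : Sec EM F V) (f : C^∞⟮𝓘(ℝ, EM), M; ℝ⟯) (x : M) :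
    L.bracket (smulSec f X) Y x = f x • L.bracket X Y x - L.act Y f x • X x := by
  rw [L.bracket_skew, L.bracket_skew X Y, ContMDiffSection.coe_neg, ContMDiffSection.coe_neg,
    Pi.neg_apply, Pi.neg_apply, L.leibniz, act]
  module

theorem act_congr (X : Sec EM F V) {f g : M → ℝ} {x : M} (h : f =ᶠ[𝓝 x] g) :
    L.act X f x = L.act X g x := by rw [act, act, differentialAt_congr h]

theorem act_mul (X : Sec EM F V) (f g : C^∞⟮𝓘(ℝ, EM), M; ℝ⟯) (x : M) :
    L.act X (f * g : C^∞⟮𝓘(ℝ, EM), M; ℝ⟯) x = f x * L.act X g x + g x * L.act X f x :=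
  differentialAt_mul f g x _

theorem act_smulSec (X : Sec EM F V) (h : C^∞⟮𝓘(ℝ, EM), M; ℝ⟯) (f : M → ℝ) (x : M) :
    L.act (smulSec h X) f x = h x * L.act X f x := by
  simp [act, smulSec_apply]

theorem act_sub (X Y : Sec EM F V) (f : M → ℝ) (x : M) :
    L.act (X - Y) f x = L.act X f x - L.act Y f x := by
  simp [act]

/-- The bracket of two sections multiplied by functions. -/
theorem bracket_smulSec_smulSec (f g : C^∞⟮𝓘(ℝ, EM), M; ℝ⟯) (X Y : Sec EM F V) (x : M) :
    L.bracket (smulSec f X) (smulSec g Y) x =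
      (f x * g x) • L.bracket X Y x + (f x * L.act X g x) • Y x - (g x * L.act Y f x) • X x := by
  rw [leibniz_left, L.leibniz, act_smulSec]
  simp only [act]
  module

variable [FiniteDimensional ℝ EM] [T2Space M]

/-- A bump function `ψ` at `x` supported where `Y` vanishes gives `ψ Y = 0`; the Leibniz rule for
`[X, ψ Y]` at `x` then reads `0 = [X, Y](x)`, since its derivative term carries the factor `Y x =
0`. -/
theorem bracket_eq_zero (X : Sec EM F V) {Y : Sec EM F V} {x : M} (h : ∀ᶠ y in 𝓝 x, Y y = 0) :
    L.bracket X Y x = 0 := by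
  obtain ⟨ψ, hψ, hsupp⟩ := exists_bump (EM := EM) x h
  have h0 : smulSec ψ Y = 0 := by
    ext y
    by_cases hy : y ∈ tsupport ψ
    · have : Y y = 0 := hsupp hy
      simp [smulSec_apply, this]
    · simp [smulSec_apply, image_eq_zero_of_notMem_tsupport hy]
  have h1 := L.leibniz X Y ψ x
  rw [h0, map_zero, hψ, one_smul, h.self_of_nhds, smul_zero, add_zero] at h1
  exact h1.symm

/-- Needed because a bivector is a sum of decomposable ones only near a point, while the bracket
takes global sections. -/
theorem bracket_congr {X X' Y Y' : Sec EM F V} {x : M} (hX : ∀ᶠ y in 𝓝 x, X y = X' y)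
    (hY : ∀ᶠ y in 𝓝 x, Y y = Y' y) : L.bracket X Y x = L.bracket X' Y' x := by
  have h1 : L.bracket X (Y - Y') x = 0 := L.bracket_eq_zero _ <| by
    filter_upwards [hY] with y hy
    simp [hy]
  have h2 : L.bracket Y' (X - X') x = 0 := L.bracket_eq_zero _ <| by
    filter_upwards [hX] with y hy
    simp [hy]
  rw [map_sub, ContMDiffSection.coe_sub, Pi.sub_apply, sub_eq_zero] at h1 h2
  rw [h1, L.bracket_skew X, L.bracket_skew X', ContMDiffSection.coe_neg, ContMDiffSection.coe_neg,
    Pi.neg_apply, Pi.neg_apply, h2]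

end LieAlgebroid

end Calculus

section Bivectors

variable {EM : Type*} [NormedAddCommGroup EM] [NormedSpace ℝ EM]
  {M : Type*} [TopologicalSpace M] [ChartedSpace EM M]
  {F : Type*} [NormedAddCommGroup F] [NormedSpace ℝ F]
  {V : M → Type*} [TopologicalSpace (TotalSpace F V)] [∀ x, TopologicalSpace (V x)]
  [∀ x, AddCommGroup (V x)] [∀ x, Module ℝ (V x)]
  [FiberBundle F V]
  {F' : Type*} [NormedAddCommGroup F'] [NormedSpace ℝ F']
  {W : M → Type*} [TopologicalSpace (TotalSpace F' W)] [∀ x, TopologicalSpace (W x)]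
  [∀ x, AddCommGroup (W x)] [∀ x, Module ℝ (W x)]
  [FiberBundle F' W]

/-! ### The Schouten square of a bivector -/

theorem DualPair.wedge_two (D : DualPair EM F V F' W) (X : Fin 2 → Sec EM F V)
    (w : Fin 2 → Sec EM F' W) (x : M) :
    D.wedge (List.ofFn X) w x = D.pair (w 0 x) (X 0 x) * D.pair (w 1 x) (X 1 x) -
      D.pair (w 0 x) (X 1 x) * D.pair (w 1 x) (X 0 x) := by
  simp [DualPair.wedge, Matrix.det_fin_two]

theorem DualPair.wedge_three (D : DualPair EM F V F' W) (X Y Z : Sec EM F V)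
    (w : Fin 3 → Sec EM F' W) (x : M) :
    D.wedge [X, Y, Z] w x =
      D.pair (w 0 x) (X x) * D.pair (w 1 x) (Y x) * D.pair (w 2 x) (Z x)
      - D.pair (w 0 x) (X x) * D.pair (w 1 x) (Z x) * D.pair (w 2 x) (Y x)
      - D.pair (w 0 x) (Y x) * D.pair (w 1 x) (X x) * D.pair (w 2 x) (Z x)
      + D.pair (w 0 x) (Y x) * D.pair (w 1 x) (Z x) * D.pair (w 2 x) (X x)
      + D.pair (w 0 x) (Z x) * D.pair (w 1 x) (X x) * D.pair (w 2 x) (Y x)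
      - D.pair (w 0 x) (Z x) * D.pair (w 1 x) (Y x) * D.pair (w 2 x) (X x) := by
  simp [DualPair.wedge, Matrix.det_fin_three]

theorem DualPair.pairSec_apply (D : DualPair EM F V F' W) (w : Sec EM F' W) (v : Sec EM F V)
    (x : M) : D.pairSec w v x = D.pair (w x) (v x) := rfl

variable [VectorBundle ℝ F V]

/-- The map `w ↦ f (⟨w, X₀⟩ X₁ - ⟨w, X₁⟩ X₀)` on sections given by the bivector `f X₀ ∧ X₁`. -/
def DualPair.sharp (D : DualPair EM F V F' W) (f : C^∞⟮𝓘(ℝ, EM), M; ℝ⟯)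
    (X : Fin 2 → Sec EM F V) (w : Sec EM F' W) : Sec EM F V :=
  smulSec (f * D.pairSec w (X 0)) (X 1) - smulSec (f * D.pairSec w (X 1)) (X 0)

theorem DualPair.pair_sharp (D : DualPair EM F V F' W) (f : C^∞⟮𝓘(ℝ, EM), M; ℝ⟯)
    (X : Fin 2 → Sec EM F V) (w w' : Sec EM F' W) (x : M) :
    D.pair (w' x) (D.sharp f X w x) =
      f x * (D.pair (w x) (X 0 x) * D.pair (w' x) (X 1 x) -
        D.pair (w x) (X 1 x) * D.pair (w' x) (X 0 x)) := by
  change D.pair (w' x) ((f x * D.pair (w x) (X 0 x)) • X 1 x -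
    (f x * D.pair (w x) (X 1 x)) • X 0 x) = _
  rw [D.pair_sub_right, D.pair_smul_right, D.pair_smul_right]
  ring

namespace LieAlgebroid

variable [IsManifold 𝓘(ℝ, EM) ∞ M] (L : LieAlgebroid EM F V) (D : DualPair EM F V F' W)

/-- The expression in two maps `S`, `T` from sections of `V*` to sections of `V` whose value for
`S = T = H` is half of the Schouten bracket of the bivector `H` with itself. -/
def halfBracket (S T : Sec EM F' W → Sec EM F V) (w : Fin 3 → Sec EM F' W) (x : M) : ℝ :=
  D.pair (w 2 x) (L.bracket (S (w 0)) (T (w 1)) x)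
    - D.pair (w 1 x) (L.bracket (S (w 0)) (T (w 2)) x)
    + D.pair (w 0 x) (L.bracket (S (w 1)) (T (w 2)) x)
    + L.act (S (w 0)) (D.pairSec (w 1) (T (w 2))) x
    - L.act (S (w 1)) (D.pairSec (w 0) (T (w 2))) x
    + L.act (S (w 2)) (D.pairSec (w 0) (T (w 1))) x

theorem schoutenTerm_two_two (f g : C^∞⟮𝓘(ℝ, EM), M; ℝ⟯) (X Y : Fin 2 → Sec EM F V)
    (w : Fin 3 → Sec EM F' W) (x : M) :
    L.schoutenTerm D f X g Y w x =
      f x * g x * (D.wedge [L.bracket (X 0) (Y 0), X 1, Y 1] w x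
        - D.wedge [L.bracket (X 0) (Y 1), X 1, Y 0] w x
        - D.wedge [L.bracket (X 1) (Y 0), X 0, Y 1] w x
        + D.wedge [L.bracket (X 1) (Y 1), X 0, Y 0] w x)
      + f x * (L.act (X 1) g x * D.wedge [X 0, Y 0, Y 1] w x
        - L.act (X 0) g x * D.wedge [X 1, Y 0, Y 1] w x)
      + g x * (L.act (Y 1) f x * D.wedge [X 0, X 1, Y 0] w x
        - L.act (Y 0) f x * D.wedge [X 0, X 1, Y 1] w x) := by
  simp [schoutenTerm, Fin.sum_univ_two, List.eraseIdx]
  ring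

theorem pair_bracket_sharp_sharp (f g : C^∞⟮𝓘(ℝ, EM), M; ℝ⟯) (X Y : Fin 2 → Sec EM F V)
    (u v w : Sec EM F' W) (x : M) :
    D.pair (w x) (L.bracket (D.sharp f X u) (D.sharp g Y v) x) =
      D.pair (w x) (L.bracket (smulSec (f * D.pairSec u (X 0)) (X 1))
        (smulSec (g * D.pairSec v (Y 0)) (Y 1)) x)
      - D.pair (w x) (L.bracket (smulSec (f * D.pairSec u (X 0)) (X 1))
        (smulSec (g * D.pairSec v (Y 1)) (Y 0)) x)
      - D.pair (w x) (L.bracket (smulSec (f * D.pairSec u (X 1)) (X 0))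
        (smulSec (g * D.pairSec v (Y 0)) (Y 1)) x)
      + D.pair (w x) (L.bracket (smulSec (f * D.pairSec u (X 1)) (X 0))
        (smulSec (g * D.pairSec v (Y 1)) (Y 0)) x) := by
  simp only [DualPair.sharp, map_sub, LinearMap.sub_apply, ContMDiffSection.coe_sub, Pi.sub_apply,
    D.pair_sub_right]
  ring

/-- Used with `a`, `b` pairings of covectors with the factors of the bivectors. The derivatives of
`a` and `b` have no counterpart in the Schouten bracket; they cancel against the `act` terms of
`halfBracket`, which is why those terms are there. -/
theorem pair_bracket_smulSec (f g a b : C^∞⟮𝓘(ℝ, EM), M; ℝ⟯) (X Y : Sec EM F V)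
    (w : Sec EM F' W) (x : M) :
    D.pair (w x) (L.bracket (smulSec (f * a) X) (smulSec (g * b) Y) x) =
      f x * a x * g x * b x * D.pair (w x) (L.bracket X Y x)
      + f x * a x * (g x * L.act X b x + b x * L.act X g x) * D.pair (w x) (Y x)
      - g x * b x * (f x * L.act Y a x + a x * L.act Y f x) * D.pair (w x) (X x) := by
  rw [bracket_smulSec_smulSec, D.pair_sub_right, D.pair_add_right, D.pair_smul_right,
    D.pair_smul_right, D.pair_smul_right, act_mul, act_mul]
  simp only [ContMDiffMap.coe_mul, Pi.mul_apply]
  ring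

theorem act_sharp (f : C^∞⟮𝓘(ℝ, EM), M; ℝ⟯) (X : Fin 2 → Sec EM F V) (w : Sec EM F' W)
    (h : M → ℝ) (x : M) :
    L.act (D.sharp f X w) h x =
      f x * D.pair (w x) (X 0 x) * L.act (X 1) h x
      - f x * D.pair (w x) (X 1 x) * L.act (X 0) h x := by
  rw [DualPair.sharp, act_sub, act_smulSec, act_smulSec]
  rfl

theorem act_pairSec_sharp (g : C^∞⟮𝓘(ℝ, EM), M; ℝ⟯) (Z : Sec EM F V) (Y : Fin 2 → Sec EM F V)
    (v w : Sec EM F' W) (x : M) :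
    L.act Z (D.pairSec w (D.sharp g Y v)) x =
      L.act Z g x * (D.pair (v x) (Y 0 x) * D.pair (w x) (Y 1 x)
        - D.pair (v x) (Y 1 x) * D.pair (w x) (Y 0 x))
      + g x * (L.act Z (D.pairSec v (Y 0)) x * D.pair (w x) (Y 1 x)
        + D.pair (v x) (Y 0 x) * L.act Z (D.pairSec w (Y 1)) x
        - L.act Z (D.pairSec v (Y 1)) x * D.pair (w x) (Y 0 x)
        - D.pair (v x) (Y 1 x) * L.act Z (D.pairSec w (Y 0)) x) := by
  have h : (D.pairSec w (D.sharp g Y v) : M → ℝ) = fun y =>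
      (g * (D.pairSec v (Y 0) * D.pairSec w (Y 1)) : C^∞⟮𝓘(ℝ, EM), M; ℝ⟯) y -
        (g * (D.pairSec v (Y 1) * D.pairSec w (Y 0)) : C^∞⟮𝓘(ℝ, EM), M; ℝ⟯) y := by
    funext y
    refine (D.pair_sharp g Y v w y).trans ?_
    simp only [ContMDiffMap.coe_mul, Pi.mul_apply, DualPair.pairSec_apply]
    ring
  rw [h, act, differentialAt_sub]
  change L.act Z _ x - L.act Z _ x = _
  simp only [act_mul]
  simp only [ContMDiffMap.coe_mul, Pi.mul_apply, DualPair.pairSec_apply]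
  ring

/-- The Schouten bracket of two decomposable bivectors. -/
theorem schoutenTerm_eq_halfBracket (f g : C^∞⟮𝓘(ℝ, EM), M; ℝ⟯) (X Y : Fin 2 → Sec EM F V)
    (w : Fin 3 → Sec EM F' W) (x : M) :
    L.schoutenTerm D f X g Y w x =
      L.halfBracket D (D.sharp f X) (D.sharp g Y) w x +
        L.halfBracket D (D.sharp g Y) (D.sharp f X) w x := by
  -- The second `halfBracket` produces brackets `[Yᵢ, Xⱼ]`, whereas the Schouten term contains only
  -- `[Xⱼ, Yᵢ]`; once they are identified, the claim is a polynomial identity.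
  have hs (i j : Fin 2) (u : Sec EM F' W) : D.pair (u x) (L.bracket (Y i) (X j) x) =
      -D.pair (u x) (L.bracket (X j) (Y i) x) := by
    rw [L.bracket_skew, ContMDiffSection.coe_neg, Pi.neg_apply]
    exact map_neg (D.toEquiv x (u x)) _
  simp only [schoutenTerm_two_two, halfBracket, pair_bracket_sharp_sharp, pair_bracket_smulSec,
    act_sharp, act_pairSec_sharp, DualPair.wedge_three, DualPair.pairSec_apply, hs]
  ring

end LieAlgebroid

end Bivectors

/-! ### From decomposable to arbitrary bivectors, and the differential of a 2-form. -/

section SchoutenSquare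

variable {EM : Type*} [NormedAddCommGroup EM] [NormedSpace ℝ EM] [FiniteDimensional ℝ EM]
  {M : Type*} [TopologicalSpace M] [T2Space M] [ChartedSpace EM M] [IsManifold 𝓘(ℝ, EM) ∞ M]
  {F : Type*} [NormedAddCommGroup F] [NormedSpace ℝ F]
  {V : M → Type*} [TopologicalSpace (TotalSpace F V)] [∀ x, TopologicalSpace (V x)]
  [∀ x, AddCommGroup (V x)] [∀ x, Module ℝ (V x)]
  [FiberBundle F V] [VectorBundle ℝ F V]
  {F' : Type*} [NormedAddCommGroup F'] [NormedSpace ℝ F']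
  {W : M → Type*} [TopologicalSpace (TotalSpace F' W)] [∀ x, TopologicalSpace (W x)]
  [∀ x, AddCommGroup (W x)] [∀ x, Module ℝ (W x)]
  [FiberBundle F' W]

/-- Turns a decomposition of the bivector, an equation between functions of two covectors, into a
decomposition of the map `H` itself, as required by `halfBracket`. Nondegeneracy of the pairing
allows this. -/
theorem Decomposition.eventually_mapSec_eq [VectorBundle ℝ F' W]
    [ContMDiffVectorBundle ∞ F' W 𝓘(ℝ, EM)] {D : DualPair EM F V F' W}
    {H : BundleMap EM F' W F V} {hH : H.IsSkew D} {x : M}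
    (d : Decomposition D (H.toBivector D hH).cochain x) :
    ∀ᶠ y in 𝓝 x, ∀ w : Sec EM F' W,
      H.mapSec w y = ∑ α, D.sharp (d.coeff α) (d.factor α) w y := by
  filter_upwards [d.eventually_eq] with y hy w
  refine D.eq_of_pair_right fun v => ?_
  -- Cochains are evaluated on global sections, so the test covector at `y` is extended to one.
  obtain ⟨s, rfl⟩ := exists_sec_eq (EM := EM) (F := F') y v
  rw [D.pair_sum_right]
  refine (hy ![w, s]).trans (Finset.sum_congr rfl fun α _ => ?_)
  rw [D.wedge_two, D.pair_sharp]
  rfl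

namespace LieAlgebroid

variable (L : LieAlgebroid EM F V) (D : DualPair EM F V F' W)

/-- `halfBracket` is biadditive in maps which are finite sums near the point. -/
theorem halfBracket_eq_sum {ι : Type*} [Fintype ι] {S : Sec EM F' W → Sec EM F V}
    {T : ι → Sec EM F' W → Sec EM F V} {x : M}
    (h : ∀ᶠ y in 𝓝 x, ∀ w, S w y = ∑ α, T α w y) (w : Fin 3 → Sec EM F' W) :
    L.halfBracket D S S w x = ∑ α, ∑ β, L.halfBracket D (T α) (T β) w x := by
  have hb (u v : Sec EM F' W) : L.bracket (S u) (S v) x =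
      ∑ α, ∑ β, L.bracket (T α u) (T β v) x := by
    have h' (u : Sec EM F' W) : ∀ᶠ y in 𝓝 x, S u y = (∑ α, T α u) y := by
      filter_upwards [h] with y hy
      rw [hy, sum_sec_apply]
    rw [L.bracket_congr (h' u) (h' v)]
    simp only [map_sum, LinearMap.sum_apply, sum_sec_apply]
    exact Finset.sum_comm
  have ha (u v v' : Sec EM F' W) : L.act (S u) (D.pairSec v (S v')) x =
      ∑ α, ∑ β, L.act (T α u) (D.pairSec v (T β v')) x := by
    have h' : (D.pairSec v (S v') : M → ℝ) =ᶠ[𝓝 x] fun y => ∑ β, D.pairSec v (T β v') y := by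
      filter_upwards [h] with y hy
      rw [D.pairSec_apply, hy, D.pair_sum_right]
      rfl
    rw [L.act_congr _ h', act, h.self_of_nhds, map_sum, map_sum]
    exact Finset.sum_congr rfl fun α _ => differentialAt_sum _ _ _ _
  simp only [halfBracket, hb, ha, D.pair_sum_right, ← Finset.sum_add_distrib,
    ← Finset.sum_sub_distrib]

/-- The Schouten bracket of a bivector with itself. -/
theorem schouten_self_eq_halfBracket [VectorBundle ℝ F' W]
    [ContMDiffVectorBundle ∞ F' W 𝓘(ℝ, EM)] {H : BundleMap EM F' W F V} (hH : H.IsSkew D)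
    (hd : ∀ x, Nonempty (Decomposition D (H.toBivector D hH).cochain x))
    (w : Fin 3 → Sec EM F' W) (x : M) :
    L.schouten D (H.toBivector D hH).cochain (H.toBivector D hH).cochain w x =
      2 * L.halfBracket D H.mapSec H.mapSec w x := by
  rw [schouten, dif_pos ⟨hd x, hd x⟩]
  -- Both arguments are the same bivector, so by proof irrelevance the two chosen decompositions are
  -- one and the same `d`. From here on nothing depends on which one was chosen.
  generalize (⟨hd x, hd x⟩ : Nonempty _ ∧ Nonempty _).1.some = d
  rw [L.halfBracket_eq_sum D d.eventually_mapSec_eq]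
  simp only [schoutenTerm_eq_halfBracket, Finset.sum_add_distrib]
  rw [two_mul]
  congr 1
  -- The second half of the sum is the first with the roles of `α` and `β` exchanged.
  exact Finset.sum_comm

omit [FiniteDimensional ℝ EM] [T2Space M] in
/-- The differential of a `2`-form. -/
theorem differential_toBivector {D : DualPair EM F' W F V} {I : BundleMap EM F V F' W}
    (hI : I.IsSkew D) (X : Fin 3 → Sec EM F V) (x : M) :
    L.differential (I.toBivector D hI).cochain X x =
      L.act (X 0) (D.pairSec (X 2) (I.mapSec (X 1))) x
      - L.act (X 1) (D.pairSec (X 2) (I.mapSec (X 0))) x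
      + L.act (X 2) (D.pairSec (X 1) (I.mapSec (X 0))) x
      - D.pair (X 2 x) (I.toFun x (L.bracket (X 0) (X 1) x))
      - D.pair (L.bracket (X 0) (X 2) x) (I.toFun x (X 1 x))
      + D.pair (L.bracket (X 1) (X 2) x) (I.toFun x (X 0 x)) := by
  have h (Y : Fin 2 → Sec EM F V) : (I.toBivector D hI).cochain Y =
    D.pairSec (Y 1) (I.mapSec (Y 0)) := rfl
  have h3 (f : Fin (2 + 1) → ℝ) : ∑ i, f i = f 0 + f 1 + f 2 := Fin.sum_univ_three f
  simp only [differential, h3, Fin.sum_univ_two, h, D.pairSec_apply, BundleMap.mapSec_apply]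
  simp [Fin.removeNth, Fin.succAbove, Fin.tail]
  ring

end LieAlgebroid

end SchoutenSquare

section Integrability

variable {EM : Type*} [NormedAddCommGroup EM] [NormedSpace ℝ EM] [FiniteDimensional ℝ EM]
  {M : Type*} [TopologicalSpace M] [T2Space M] [ChartedSpace EM M] [IsManifold 𝓘(ℝ, EM) ∞ M]
  {F : Type*} [NormedAddCommGroup F] [NormedSpace ℝ F] [FiniteDimensional ℝ F]
  {V : M → Type*} [TopologicalSpace (TotalSpace F V)] [∀ x, TopologicalSpace (V x)]
  [∀ x, AddCommGroup (V x)] [∀ x, Module ℝ (V x)]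
  [FiberBundle F V] [VectorBundle ℝ F V] [ContMDiffVectorBundle ∞ F V 𝓘(ℝ, EM)]
  {F' : Type*} [NormedAddCommGroup F'] [NormedSpace ℝ F'] [FiniteDimensional ℝ F']
  {W : M → Type*} [TopologicalSpace (TotalSpace F' W)] [∀ x, TopologicalSpace (W x)]
  [∀ x, AddCommGroup (W x)] [∀ x, Module ℝ (W x)]
  [FiberBundle F' W] [VectorBundle ℝ F' W] [ContMDiffVectorBundle ∞ F' W 𝓘(ℝ, EM)]

/-! ### Integrability of the graph of a skew-symmetric bundle map -/

omit [FiniteDimensional ℝ EM] [T2Space M] [FiniteDimensional ℝ F]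
  [ContMDiffVectorBundle ∞ F V 𝓘(ℝ, EM)] [VectorBundle ℝ F' W] [FiniteDimensional ℝ F']
  [ContMDiffVectorBundle ∞ F' W 𝓘(ℝ, EM)] in
theorem LieAlgebroid.pair_grad (L : LieAlgebroid EM F V) (D : DualPair EM F V F' W) (f : M → ℝ)
    (X : Sec EM F V) (x : M) : D.pair (L.grad D f x) (X x) = L.act X f x := by
  rw [DualPair.pair, grad, LinearEquiv.apply_symm_apply]
  rfl

omit [FiniteDimensional ℝ EM] [T2Space M] [FiniteDimensional ℝ F]
  [ContMDiffVectorBundle ∞ F V 𝓘(ℝ, EM)] [VectorBundle ℝ F' W] [FiniteDimensional ℝ F']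
  [ContMDiffVectorBundle ∞ F' W 𝓘(ℝ, EM)] in
theorem LieAlgebroid.grad_neg (L : LieAlgebroid EM F V) (D : DualPair EM F V F' W) (f : M → ℝ)
    (x : M) : L.grad D (fun y => -f y) x = -L.grad D f x := by
  rw [grad, grad, ← map_neg]
  congr 1
  ext v
  exact differentialAt_neg f x _

omit [FiniteDimensional ℝ EM] [T2Space M] [FiniteDimensional ℝ F] [VectorBundle ℝ F V]
  [ContMDiffVectorBundle ∞ F V 𝓘(ℝ, EM)] [VectorBundle ℝ F' W] [FiniteDimensional ℝ F']
  [ContMDiffVectorBundle ∞ F' W 𝓘(ℝ, EM)] [IsManifold 𝓘(ℝ, EM) ∞ M] in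
theorem BundleMap.IsSkew.pairSec_mapSec {D : DualPair EM F V F' W} {H : BundleMap EM F' W F V}
    (hH : H.IsSkew D) (u v : Sec EM F' W) :
    (D.pairSec u (H.mapSec v) : M → ℝ) = fun y => -D.pairSec v (H.mapSec u) y :=
  funext fun y => hH y (u y) (v y)

variable (L : LieAlgebroid EM F V) (L' : LieAlgebroid EM F' W)
  (D : DualPair EM F V F' W) (D' : DualPair EM F' W F V)

/-- The component in `V` of the bracket in `V ⊕ W` of `Hu + u` and `Hv + v`. -/
def graphBracketBase (H : BundleMap EM F' W F V) (u v : Sec EM F' W) (x : M) : V x :=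
  L.bracket (H.mapSec u) (H.mapSec v) x + L'.lieDer D' u (H.mapSec v) x
    - L'.lieDer D' v (H.mapSec u) x - L'.grad D' (D.pairSec u (H.mapSec v)) x

/-- The component in the dual `W` of `V` of the bracket in `V ⊕ W` of `Hu + u` and `Hv + v`. -/
def graphBracketDual (H : BundleMap EM F' W F V) (u v : Sec EM F' W) (x : M) : W x :=
  L'.bracket u v x + L.lieDer D (H.mapSec u) v x - L.lieDer D (H.mapSec v) u x
    + L.grad D (D.pairSec u (H.mapSec v)) x

variable {D D'}

/-- The failure of `Hu + u` and `Hv + v` to have a bracket in the graph of `H`. -/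
theorem pair_graphBracket (hD : ∀ (x : M) (v : V x) (w : W x), D'.pair v w = D.pair w v)
    {H : BundleMap EM F' W F V} (hH : H.IsSkew D) (u : Fin 3 → Sec EM F' W) (x : M) :
    D.pair (u 2 x) (graphBracketBase L L' D D' H (u 0) (u 1) x
        - H.toFun x (graphBracketDual L L' D H (u 0) (u 1) x)) =
      L'.differential (H.toBivector D hH).cochain u x
        + L.halfBracket D H.mapSec H.mapSec u x := by
  have hD' (v : Sec EM F V) (w : Sec EM F' W) : (D'.pairSec v w : M → ℝ) = D.pairSec w v :=
    funext fun y => hD y _ _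
  have hact (X : Sec EM F' W) (f : M → ℝ) : L'.act X (fun y => -f y) x = -L'.act X f x :=
    differentialAt_neg f x _
  -- Skewness turns `-⟨u₂, H ζ⟩` into `⟨ζ, H u₂⟩` for `ζ` the `W`-component of the bracket, so that
  -- the Lie derivatives in `ζ` are paired with a section of `V`.
  rw [L'.differential_toBivector, LieAlgebroid.halfBracket, D.pair_sub_right, hH x (u 2 x),
    hH x (u 2 x) (L'.bracket (u 0) (u 1) x), hH.pairSec_mapSec (u 1) (u 0), hact]
  -- Lie derivatives for `L'` are defined through `D'` and those for `L` through `D`; pairings are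
  -- therefore rewritten from `D` to `D'` and afterwards back.
  simp only [graphBracketBase, graphBracketDual, D.pair_add_right, D.pair_sub_right,
    D.pair_add_left, D.pair_sub_left, ← BundleMap.mapSec_apply, LieAlgebroid.pair_lieDer,
    LieAlgebroid.pair_grad, ← hD x, hD']
  simp only [hD x, LieAlgebroid.pair_lieDer, LieAlgebroid.pair_grad]
  ring

/-- The common core of both halves of the theorem. Taking `D'` with the compatibility `hD`, and not
`D.flip`, lets the pairs (`dualPair`, its flip) and (its flip, `dualPair`) be used alike. Equality
of the components at a point is tested by a third section with arbitrary value there. -/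
theorem graphBracket_mem_iff (hD : ∀ (x : M) (v : V x) (w : W x), D'.pair v w = D.pair w v)
    {H : BundleMap EM F' W F V} (hH : H.IsSkew D)
    (hd : ∀ x, Nonempty (Decomposition D (H.toBivector D hH).cochain x)) :
    (∀ u v x, graphBracketBase L L' D D' H u v x =
        H.toFun x (graphBracketDual L L' D H u v x)) ↔
      L'.differential (H.toBivector D hH).cochain +
        (1 / 2 : ℝ) • L.schouten D (H.toBivector D hH).cochain (H.toBivector D hH).cochain = 0 := by
  have key (u : Fin 3 → Sec EM F' W) (x : M) : (L'.differential (H.toBivector D hH).cochain +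
        (1 / 2 : ℝ) • L.schouten D (H.toBivector D hH).cochain (H.toBivector D hH).cochain :
          Cochain EM F' W (2 + 1)) u x =
      D.pair (u 2 x) (graphBracketBase L L' D D' H (u 0) (u 1) x
        - H.toFun x (graphBracketDual L L' D H (u 0) (u 1) x)) := by
    rw [pair_graphBracket L L' hD hH]
    simp only [Pi.add_apply, Pi.smul_apply, smul_eq_mul]
    rw [L.schouten_self_eq_halfBracket D hH hd]
    ring
  constructor
  · intro h
    funext u x
    rw [key, h, sub_self]
    exact map_zero (D.toEquiv x (u 2 x))
  · intro h u v x
    rw [← sub_eq_zero]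
    refine D.eq_of_pair_right fun w => ?_
    obtain ⟨s, rfl⟩ := exists_sec_eq (EM := EM) (F := F') x w
    refine (key ![u, v, s] x).symm.trans ?_
    rw [h]
    exact (map_zero (D.toEquiv x (s x))).symm

end Integrability

/-! ### Local frames -/

section Frames

variable {EM : Type*} [NormedAddCommGroup EM] [NormedSpace ℝ EM]
  {M : Type*} [TopologicalSpace M] [ChartedSpace EM M]
  {F : Type*} [NormedAddCommGroup F] [NormedSpace ℝ F]
  {V : M → Type*} [TopologicalSpace (TotalSpace F V)] [∀ x, TopologicalSpace (V x)]
  [∀ x, AddCommGroup (V x)] [∀ x, Module ℝ (V x)]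
  [FiberBundle F V]
  {F' : Type*} [NormedAddCommGroup F'] [NormedSpace ℝ F']
  {W : M → Type*} [TopologicalSpace (TotalSpace F' W)] [∀ x, TopologicalSpace (W x)]
  [∀ x, AddCommGroup (W x)] [∀ x, Module ℝ (W x)]
  [FiberBundle F' W]

/-- Local dual frames give local expressions of bivectors by decomposable ones. -/
theorem nonempty_decomposition_toBivector {ι : Type*} [Fintype ι] {D : DualPair EM F V F' W}
    {H : BundleMap EM F' W F V} (hH : H.IsSkew D) (e : ι → Sec EM F V) (ε : ι → Sec EM F' W) {x : M}
    (h : ∀ᶠ y in 𝓝 x, ∀ w : W y, w = ∑ i, D.pair w (e i y) • ε i y) :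
    Nonempty (Decomposition D (H.toBivector D hH).cochain x) := by
  let φ := Fintype.equivFin (ι × ι)
  refine ⟨⟨Fintype.card (ι × ι),
    -- `H = ½ ∑ᵢⱼ ⟨εⱼ, H εᵢ⟩ eᵢ ∧ eⱼ`; the factor `1 / 2` is there because the sum runs over all
    -- ordered pairs.
    fun α => ContMDiffMap.const (1 / 2) * D.pairSec (ε (φ.symm α).2) (H.mapSec (ε (φ.symm α).1)),
    fun α => ![e (φ.symm α).1, e (φ.symm α).2], ?_⟩⟩
  filter_upwards [h] with y hy w
  rw [φ.symm.sum_comp fun p : ι × ι => (ContMDiffMap.const (1 / 2) *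
    D.pairSec (ε p.2) (H.mapSec (ε p.1)) : C^∞⟮𝓘(ℝ, EM), M; ℝ⟯) y *
      D.wedge (List.ofFn ![e p.1, e p.2]) w y, Fintype.sum_prod_type]
  have hP (v v' : W y) : D.pair v' (H.toFun y v) =
      ∑ i, ∑ j, D.pair v (e i y) * D.pair v' (e j y) * D.pair (ε j y) (H.toFun y (ε i y)) := by
    conv_lhs => rw [hy v, hy v']
    simp only [map_sum, map_smul, D.pair_sum_left, D.pair_sum_right, D.pair_smul_left,
      D.pair_smul_right]
    rw [Finset.sum_comm]
    exact Finset.sum_congr rfl fun i _ => Finset.sum_congr rfl fun j _ => by ring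
  have h0 : (H.toBivector D hH).cochain w y = D.pair (w 1 y) (H.toFun y (w 0 y)) := rfl
  -- Antisymmetrizing matches the two terms of the determinant that evaluates `eᵢ ∧ eⱼ`.
  have h1 : D.pair (w 1 y) (H.toFun y (w 0 y)) =
      1 / 2 * (D.pair (w 1 y) (H.toFun y (w 0 y)) - D.pair (w 0 y) (H.toFun y (w 1 y))) := by
    rw [hH y (w 0 y)]
    ring
  rw [h0, h1, hP, hP]
  simp only [← Finset.sum_sub_distrib, Finset.mul_sum]
  refine Finset.sum_congr rfl fun i _ => Finset.sum_congr rfl fun j _ => ?_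
  rw [D.wedge_two]
  change _ = 1 / 2 * D.pair (ε j y) (H.toFun y (ε i y)) *
    (D.pair (w 0 y) (e i y) * D.pair (w 1 y) (e j y) -
      D.pair (w 0 y) (e j y) * D.pair (w 1 y) (e i y))
  ring

variable [VectorBundle ℝ F V] [FiniteDimensional ℝ EM] [T2Space M] [IsManifold 𝓘(ℝ, EM) ∞ M]

/-- The value `1` is needed on a neighbourhood, not just at `x`: cut-off sections must keep their
germs, since brackets involve derivatives. -/
theorem exists_bump_eventually_one {u : Set M} (x : M) (hu : u ∈ 𝓝 x) :
    ∃ ψ : C^∞⟮𝓘(ℝ, EM), M; ℝ⟯, (∀ᶠ y in 𝓝 x, ψ y = 1) ∧ tsupport ψ ⊆ u := by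
  obtain ⟨f, -, hf⟩ := (SmoothBumpFunction.nhds_basis_tsupport (I := 𝓘(ℝ, EM)) x).mem_iff.1 hu
  exact ⟨⟨f, f.contMDiff⟩, f.eventuallyEq_one, hf⟩

/-- A smooth section over an open set agrees near each point with a global smooth section. -/
theorem exists_sec_eventuallyEq {u : Set M} (hu : IsOpen u) {x : M} (hx : x ∈ u)
    {s : ∀ y, V y}
    (hs : ContMDiffOn 𝓘(ℝ, EM) (𝓘(ℝ, EM).prod 𝓘(ℝ, F)) ∞ (fun y => TotalSpace.mk' F y (s y)) u) :
    ∃ t : Sec EM F V, ∀ᶠ y in 𝓝 x, t y = s y := by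
  obtain ⟨ψ, hψ, hsupp⟩ := exists_bump_eventually_one (EM := EM) x (hu.mem_nhds hx)
  refine ⟨⟨fun y => ((ψ : M → ℝ) • s) y,
    ContMDiffOn.smul_section_of_tsupport ψ.contMDiff.contMDiffOn hu hsupp hs⟩, ?_⟩
  filter_upwards [hψ] with y hy
  change ψ y • s y = s y
  rw [hy, one_smul]

variable [FiniteDimensional ℝ F] [ContMDiffVectorBundle ∞ F V 𝓘(ℝ, EM)]
  [∀ x, IsTopologicalAddGroup (V x)] [∀ x, ContinuousSMul ℝ (V x)]

/-- A basis of the model fibre and its coordinate functionals, carried over by the trivializations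
of `V` and `V*`, are dual frames over a neighbourhood; cutting off makes them global without
changing them near `x`. -/
theorem exists_dual_frames (x : M) : ∃ (e : Fin (Module.finrank ℝ F) → Sec EM F V)
    (ε : Fin (Module.finrank ℝ F) → Sec EM (F →L[ℝ] ℝ) (DualBundle V)),
    ∀ᶠ y in 𝓝 x, ∀ v : V y, v = ∑ i, (dualPair EM F V).pair (ε i y) v • e i y := by
  let b := Module.finBasis ℝ F
  let t := trivializationAt F V x
  let t' := trivializationAt (F →L[ℝ] ℝ) (DualBundle V) x
  have hx : x ∈ t.baseSet := FiberBundle.mem_baseSet_trivializationAt F V x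
  have hx' : x ∈ t'.baseSet := FiberBundle.mem_baseSet_trivializationAt _ (DualBundle V) x
  choose e he using fun i => exists_sec_eventuallyEq t.open_baseSet hx
    (t.contMDiffOn_localFrame_baseSet (I := 𝓘(ℝ, EM)) ∞ b i)
  have hsm (i) : ContMDiffOn 𝓘(ℝ, EM) (𝓘(ℝ, EM).prod 𝓘(ℝ, F →L[ℝ] ℝ)) ∞
      (fun y => TotalSpace.mk' (F →L[ℝ] ℝ) y
        (t'.symm y (LinearMap.toContinuousLinearMap (b.coord i)))) t'.baseSet := by
    rw [t'.contMDiffOn_section_baseSet_iff]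
    refine (contMDiffOn_const (c := LinearMap.toContinuousLinearMap (b.coord i))).congr
      fun y hy => ?_
    rw [t'.apply_mk_symm hy]
  choose ε hε using fun i => exists_sec_eventuallyEq t'.open_baseSet hx' (hsm i)
  refine ⟨e, ε, ?_⟩
  filter_upwards [Filter.eventually_all.2 he, Filter.eventually_all.2 hε,
    t.open_baseSet.mem_nhds hx, t'.open_baseSet.mem_nhds hx'] with y hey hεy hy hy' v
  have hc (i) : (dualPair EM F V).pair (ε i y) v = (t.basisAt b hy).repr v i := by
    rw [dualPair_pair, hεy]
    -- The trivialization of `V*` is the one induced by that of `V`: a functional on `F` goes back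
    -- to the fibre by composition with the trivialization of `V`. Hence `ε i` reads off the `i`-th
    -- coordinate in the frame.
    have h := Pretrivialization.continuousLinearMap_symm_apply' (RingHom.id ℝ) t
      (trivializationAt ℝ (Bundle.Trivial M ℝ) x) (b := y) ⟨hy, Set.mem_univ y⟩
      (LinearMap.toContinuousLinearMap (b.coord i))
    have h' : t'.symm y (LinearMap.toContinuousLinearMap (b.coord i)) = _ := h
    rw [h']
    simp [Trivialization.basisAt, t.linearMapAt_apply, hy]
  conv_lhs => rw [← (t.basisAt b hy).sum_repr v]
  refine Finset.sum_congr rfl fun i _ => ?_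
  rw [hc, hey, t.localFrame_apply_of_mem_baseSet b hy]

end Frames

/-! ### Images of injective bundle maps -/

section BundleMaps

variable {EM : Type*} [NormedAddCommGroup EM] [NormedSpace ℝ EM]
  {M : Type*} [TopologicalSpace M] [ChartedSpace EM M]
  {F : Type*} [NormedAddCommGroup F] [NormedSpace ℝ F]
  {V : M → Type*} [TopologicalSpace (TotalSpace F V)] [∀ x, TopologicalSpace (V x)]
  [∀ x, AddCommGroup (V x)] [∀ x, Module ℝ (V x)]
  [FiberBundle F V]
  {F₁ : Type*} [NormedAddCommGroup F₁] [NormedSpace ℝ F₁]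
  {V₁ : M → Type*} [TopologicalSpace (TotalSpace F₁ V₁)] [∀ x, TopologicalSpace (V₁ x)]
  [∀ x, AddCommGroup (V₁ x)] [∀ x, Module ℝ (V₁ x)]
  [FiberBundle F₁ V₁]
  {F₂ : Type*} [NormedAddCommGroup F₂] [NormedSpace ℝ F₂]
  {V₂ : M → Type*} [TopologicalSpace (TotalSpace F₂ V₂)] [∀ x, TopologicalSpace (V₂ x)]
  [∀ x, AddCommGroup (V₂ x)] [∀ x, Module ℝ (V₂ x)]
  [FiberBundle F₂ V₂]

variable (EM F V) in
/-- The identity bundle map. -/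
def BundleMap.id : BundleMap EM F V F V where
  toFun _ := LinearMap.id
  contMDiff := contMDiff_id

/-- The bundle map `v ↦ (S v, T v)` into a direct sum. -/
def BundleMap.prod (S : BundleMap EM F V F₁ V₁) (T : BundleMap EM F V F₂ V₂) :
    BundleMap EM F V (F₁ × F₂) (V₁ ×ᵇ V₂) where
  toFun x := (S.toFun x).prod (T.toFun x)
  contMDiff := by
    intro v
    have hS := Bundle.contMDiffAt_totalSpace.1 (S.contMDiff v)
    have hT := Bundle.contMDiffAt_totalSpace.1 (T.contMDiff v)
    exact Bundle.contMDiffAt_totalSpace.2 ⟨hS.1, hS.2.prodMk_space hT.2⟩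

/-- A fibrewise injective map carries a local frame of `V` to linearly independent smooth sections
spanning the image. -/
theorem BundleMap.isSubbundle_range [VectorBundle ℝ F V] [FiniteDimensional ℝ F]
    [IsManifold 𝓘(ℝ, EM) ∞ M]
    [ContMDiffVectorBundle ∞ F V 𝓘(ℝ, EM)] (S : BundleMap EM F V F₁ V₁)
    (hS : ∀ x, Function.Injective (S.toFun x)) :
    IsSubbundle EM F₁ V₁ fun x => LinearMap.range (S.toFun x) := by
  intro x
  let b := Module.finBasis ℝ F
  let t := trivializationAt F V x
  refine ⟨t.baseSet, t.open_baseSet, FiberBundle.mem_baseSet_trivializationAt F V x, _,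
    fun i y => S.toFun y (t.localFrame b i y), fun i => ?_, fun y hy => ?_⟩
  · exact S.contMDiff.comp_contMDiffOn
      (t.contMDiffOn_localFrame_baseSet (I := 𝓘(ℝ, EM)) ∞ b i)
  · have h : (fun i => S.toFun y (t.localFrame b i y)) = S.toFun y ∘ t.basisAt b hy :=
      funext fun i => by rw [t.localFrame_apply_of_mem_baseSet b hy]; rfl
    rw [h]
    refine ⟨(t.basisAt b hy).linearIndependent.map' _ (LinearMap.ker_eq_bot.2 (hS y)), ?_⟩
    rw [Set.range_comp, Submodule.span_image, (t.basisAt b hy).span_eq, Submodule.map_top]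

end BundleMaps

/-! ### Graphs in the double -/

section Graphs

variable {EM : Type*} [NormedAddCommGroup EM] [NormedSpace ℝ EM] [FiniteDimensional ℝ EM]
  {M : Type*} [TopologicalSpace M] [T2Space M] [ChartedSpace EM M] [IsManifold 𝓘(ℝ, EM) ∞ M]
  {F : Type*} [NormedAddCommGroup F] [NormedSpace ℝ F] [FiniteDimensional ℝ F]
  {A : M → Type*} [TopologicalSpace (TotalSpace F A)] [∀ x, TopologicalSpace (A x)]
  [∀ x, AddCommGroup (A x)] [∀ x, Module ℝ (A x)]
  [∀ x, IsTopologicalAddGroup (A x)] [∀ x, ContinuousSMul ℝ (A x)]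
  [FiberBundle F A] [VectorBundle ℝ F A] [ContMDiffVectorBundle ∞ F A 𝓘(ℝ, EM)]

omit [FiniteDimensional ℝ EM] [T2Space M] [IsManifold 𝓘(ℝ, EM) ∞ M]
  [ContMDiffVectorBundle ∞ F A 𝓘(ℝ, EM)] in
/-- Maximal isotropy of the graphs is skew-symmetry. -/
theorem isSkew_iff_maximal_graphOfDual
    (H : BundleMap EM (F →L[ℝ] ℝ) (DualBundle A) F A) :
    H.IsSkew (dualPair EM F A) ↔ ∀ x, Maximal (fun S : Submodule ℝ ((A ×ᵇ DualBundle A) x) =>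
      ∀ u ∈ S, ∀ v ∈ S, pairingPlus (EM := EM) (F := F) u v = 0) (graphOfDual H x) := by
  constructor
  · intro hH x
    constructor
    · rintro _ ⟨w₁, rfl⟩ _ ⟨w₂, rfl⟩
      change 1 / 2 * ((dualPair EM F A).pair w₁ (H.toFun x w₂) +
        (dualPair EM F A).pair w₂ (H.toFun x w₁)) = 0
      rw [hH x w₁]
      ring
    · rintro S hS hle ⟨X, ξ⟩ hv
      refine ⟨ξ, Prod.ext ?_ rfl⟩
      refine (dualPair EM F A).eq_of_pair_right fun w => ?_
      -- An isotropic `S` containing the graph makes `(X, ξ)` orthogonal to each `(H w, w)`; by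
      -- skewness this forces `X = H ξ`.
      have h : 1 / 2 * ((dualPair EM F A).pair w X + (dualPair EM F A).pair ξ (H.toFun x w)) = 0 :=
        hS (H.toFun x w, w) (hle ⟨w, rfl⟩) (X, ξ) hv
      change (dualPair EM F A).pair w (H.toFun x ξ) = _
      rw [hH x w]
      linarith
  · intro h x w₁ w₂
    have h' : 1 / 2 * ((dualPair EM F A).pair w₁ (H.toFun x w₂) +
        (dualPair EM F A).pair w₂ (H.toFun x w₁)) = 0 :=
      (h x).prop (H.toFun x w₁, w₁) ⟨w₁, rfl⟩ (H.toFun x w₂, w₂) ⟨w₂, rfl⟩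
    linarith

omit [FiniteDimensional ℝ EM] [T2Space M] [IsManifold 𝓘(ℝ, EM) ∞ M]
  [ContMDiffVectorBundle ∞ F A 𝓘(ℝ, EM)] in
theorem isSkew_iff_maximal_graph
    (I : BundleMap EM F A (F →L[ℝ] ℝ) (DualBundle A)) :
    I.IsSkew (dualPair EM F A).flip ↔ ∀ x, Maximal (fun S : Submodule ℝ ((A ×ᵇ DualBundle A) x) =>
      ∀ u ∈ S, ∀ v ∈ S, pairingPlus (EM := EM) (F := F) u v = 0) (graph I x) := by
  constructor
  · intro hI x
    have hI' (X₁ X₂ : A x) : (dualPair EM F A).pair (I.toFun x X₂) X₁ =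
        -(dualPair EM F A).pair (I.toFun x X₁) X₂ := hI x X₁ X₂
    constructor
    · rintro _ ⟨X₁, rfl⟩ _ ⟨X₂, rfl⟩
      change 1 / 2 * ((dualPair EM F A).pair (I.toFun x X₁) X₂ +
        (dualPair EM F A).pair (I.toFun x X₂) X₁) = 0
      rw [hI' X₁]
      ring
    · rintro S hS hle ⟨X, ξ⟩ hv
      refine ⟨X, Prod.ext rfl ?_⟩
      refine (dualPair EM F A).eq_of_pair_left fun Y => ?_
      have h : 1 / 2 * ((dualPair EM F A).pair (I.toFun x Y) X + (dualPair EM F A).pair ξ Y) = 0 :=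
        hS (Y, I.toFun x Y) (hle ⟨Y, rfl⟩) (X, ξ) hv
      change (dualPair EM F A).pair (I.toFun x X) Y = _
      rw [hI' Y]
      linarith
  · intro h x X₁ X₂
    have h' : 1 / 2 * ((dualPair EM F A).pair (I.toFun x X₁) X₂ +
        (dualPair EM F A).pair (I.toFun x X₂) X₁) = 0 :=
      (h x).prop (X₁, I.toFun x X₁) ⟨X₁, rfl⟩ (X₂, I.toFun x X₂) ⟨X₂, rfl⟩
    change (dualPair EM F A).pair (I.toFun x X₂) X₁ = -(dualPair EM F A).pair (I.toFun x X₁) X₂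
    linarith

/-! ### The bracket of the double on sections of a graph, and the two equivalences. -/

namespace LieBialgebroid

variable (B : LieBialgebroid EM F A)

/-- By skewness the two terms of `(e₁, e₂)₋` coincide, so `½(⟨ξ₁, Hξ₂⟩ - ⟨ξ₂, Hξ₁⟩) = ⟨ξ₁, Hξ₂⟩`. -/
theorem doubleBracket_graphOfDual {H : BundleMap EM (F →L[ℝ] ℝ) (DualBundle A) F A}
    (hH : H.IsSkew (dualPair EM F A))
    {e₁ e₂ : Sec EM (F × (F →L[ℝ] ℝ)) (A ×ᵇ DualBundle A)}
    (h₁ : secFst e₁ = H.mapSec (secSnd e₁)) (h₂ : secFst e₂ = H.mapSec (secSnd e₂)) (x : M) :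
    B.doubleBracket e₁ e₂ x =
      (graphBracketBase B.alg B.dual (dualPair EM F A) (dualPair EM F A).flip H
        (secSnd e₁) (secSnd e₂) x,
      graphBracketDual B.alg B.dual (dualPair EM F A) H (secSnd e₁) (secSnd e₂) x) := by
  have hm : pairingMinus e₁ e₂ = (dualPair EM F A).pairSec (secSnd e₁) (H.mapSec (secSnd e₂)) := by
    have h : pairingMinus e₁ e₂ = fun y =>
        1 / 2 * ((dualPair EM F A).pairSec (secSnd e₁) (secFst e₂) y -
          (dualPair EM F A).pairSec (secSnd e₂) (secFst e₁) y) := rfl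
    rw [h, h₁, h₂, hH.pairSec_mapSec (secSnd e₁)]
    funext y
    ring
  rw [doubleBracket, hm, h₁, h₂]
  rfl

/-- Exchanging `A` and `A*` changes the sign of `(e₁, e₂)₋`, which is now `-⟨IX₂, X₁⟩`. This
compensates for the opposite signs of the `d_*` and `d` terms, so the same two expressions appear
with the structures exchanged. -/
theorem doubleBracket_graph {I : BundleMap EM F A (F →L[ℝ] ℝ) (DualBundle A)}
    (hI : I.IsSkew (dualPair EM F A).flip)
    {e₁ e₂ : Sec EM (F × (F →L[ℝ] ℝ)) (A ×ᵇ DualBundle A)}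
    (h₁ : secSnd e₁ = I.mapSec (secFst e₁)) (h₂ : secSnd e₂ = I.mapSec (secFst e₂)) (x : M) :
    B.doubleBracket e₁ e₂ x =
      (graphBracketDual B.dual B.alg (dualPair EM F A).flip I (secFst e₁) (secFst e₂) x,
      graphBracketBase B.dual B.alg (dualPair EM F A).flip (dualPair EM F A) I
        (secFst e₁) (secFst e₂) x) := by
  have hm : pairingMinus e₁ e₂ =
      fun y => -(dualPair EM F A).flip.pairSec (secFst e₁) (I.mapSec (secFst e₂)) y := by
    have h : pairingMinus e₁ e₂ = fun y =>
        1 / 2 * ((dualPair EM F A).flip.pairSec (secFst e₂) (secSnd e₁) y -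
          (dualPair EM F A).flip.pairSec (secFst e₁) (secSnd e₂) y) := rfl
    rw [h, h₁, h₂, hI.pairSec_mapSec (secFst e₁)]
    funext y
    ring
  rw [doubleBracket, hm, h₁, h₂]
  simp only [LieAlgebroid.grad_neg, sub_neg_eq_add, ← sub_eq_add_neg]
  rfl

theorem isDirac_graphOfDual_iff (H : BundleMap EM (F →L[ℝ] ℝ) (DualBundle A) F A) :
    B.IsDirac (graphOfDual H) ↔ ∃ hH : H.IsSkew (dualPair EM F A),
      B.dual.differential (H.toBivector (dualPair EM F A) hH).cochain +
        (1 / 2 : ℝ) • B.alg.schouten (dualPair EM F A)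
          (H.toBivector (dualPair EM F A) hH).cochain
          (H.toBivector (dualPair EM F A) hH).cochain = 0 := by
  have hd (hH : H.IsSkew (dualPair EM F A)) (x : M) :
      Nonempty (Decomposition (dualPair EM F A) (H.toBivector (dualPair EM F A) hH).cochain x) := by
    obtain ⟨e, ε, h⟩ := exists_dual_frames (EM := EM) (F := F) (V := A) x
    refine nonempty_decomposition_toBivector hH e ε ?_
    -- The frames expand vectors of `A`, while covectors have to be expanded here; pairing with an
    -- arbitrary `v` passes from one expansion to the other.
    filter_upwards [h] with y hy w
    refine (dualPair EM F A).eq_of_pair_left fun v => ?_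
    conv_lhs => rw [hy v]
    rw [DualPair.pair_sum_right, DualPair.pair_sum_left]
    refine Finset.sum_congr rfl fun i _ => ?_
    rw [DualPair.pair_smul_right, DualPair.pair_smul_left, mul_comm]
  have hD (x : M) (v : A x) (w : DualBundle A x) :
      (dualPair EM F A).flip.pair v w = (dualPair EM F A).pair w v := rfl
  -- The parametrization `ξ ↦ Hξ + ξ` of the graph: it lifts sections of `A*` to sections of the
  -- graph and, being injective, exhibits the graph as a subbundle.
  let J := H.prod (BundleMap.id EM (F →L[ℝ] ℝ) (DualBundle A))
  constructor
  · intro hB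
    have hH := (isSkew_iff_maximal_graphOfDual H).2 hB.maximal_isotropic
    refine ⟨hH, (graphBracket_mem_iff B.alg B.dual hD hH (hd hH)).1 fun u v x => ?_⟩
    have h := hB.integrable (J.mapSec u) (J.mapSec v) (fun y => ⟨u y, rfl⟩) (fun y => ⟨v y, rfl⟩) x
    rw [B.doubleBracket_graphOfDual hH rfl rfl] at h
    obtain ⟨w, hw⟩ := h
    obtain ⟨h1, h2⟩ := Prod.ext_iff.1 hw
    exact h1.symm.trans (congrArg (H.toFun x) h2)
  · rintro ⟨hH, h⟩
    refine ⟨J.isSubbundle_range fun x w w' hw => (Prod.ext_iff.1 hw).2,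
      (isSkew_iff_maximal_graphOfDual H).1 hH, fun e₁ e₂ h₁ h₂ x => ?_⟩
    -- Every section of the graph is `Hξ + ξ` with `ξ` its own component in `A*`, so testing
    -- brackets of such sections suffices.
    have hs (e : Sec EM (F × (F →L[ℝ] ℝ)) (A ×ᵇ DualBundle A)) (he : ∀ x, e x ∈ graphOfDual H x) :
        secFst e = H.mapSec (secSnd e) := by
      ext y
      obtain ⟨w, hw⟩ := he y
      obtain ⟨h1, h2⟩ := Prod.ext_iff.1 hw
      exact h1.symm.trans (congrArg (H.toFun y) h2)
    rw [B.doubleBracket_graphOfDual hH (hs e₁ h₁) (hs e₂ h₂)]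
    exact ⟨_, Prod.ext ((graphBracket_mem_iff B.alg B.dual hD hH (hd hH)).2 h _ _ x).symm rfl⟩

theorem isDirac_graph_iff (I : BundleMap EM F A (F →L[ℝ] ℝ) (DualBundle A)) :
    B.IsDirac (graph I) ↔ ∃ hI : I.IsSkew (dualPair EM F A).flip,
      B.alg.differential (I.toBivector (dualPair EM F A).flip hI).cochain +
        (1 / 2 : ℝ) • B.dual.schouten (dualPair EM F A).flip
          (I.toBivector (dualPair EM F A).flip hI).cochain
          (I.toBivector (dualPair EM F A).flip hI).cochain = 0 := by
  have hd (hI : I.IsSkew (dualPair EM F A).flip) (x : M) :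
      Nonempty (Decomposition (dualPair EM F A).flip
        (I.toBivector (dualPair EM F A).flip hI).cochain x) := by
    obtain ⟨e, ε, h⟩ := exists_dual_frames (EM := EM) (F := F) (V := A) x
    -- For `A*` the two dual frames exchange roles, and the expansion of vectors of `A` is exactly
    -- what is required.
    exact nonempty_decomposition_toBivector hI ε e h
  have hD (x : M) (v : DualBundle A x) (w : A x) :
      (dualPair EM F A).pair v w = (dualPair EM F A).flip.pair w v := rfl
  let J := (BundleMap.id EM F A).prod I
  constructor
  · intro hB
    have hI := (isSkew_iff_maximal_graph I).2 hB.maximal_isotropic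
    refine ⟨hI, (graphBracket_mem_iff B.dual B.alg hD hI (hd hI)).1 fun u v x => ?_⟩
    have h := hB.integrable (J.mapSec u) (J.mapSec v) (fun y => ⟨u y, rfl⟩) (fun y => ⟨v y, rfl⟩) x
    rw [B.doubleBracket_graph hI rfl rfl] at h
    obtain ⟨w, hw⟩ := h
    obtain ⟨h1, h2⟩ := Prod.ext_iff.1 hw
    exact h2.symm.trans (congrArg (I.toFun x) h1)
  · rintro ⟨hI, h⟩
    refine ⟨J.isSubbundle_range fun x w w' hw => (Prod.ext_iff.1 hw).1,
      (isSkew_iff_maximal_graph I).1 hI, fun e₁ e₂ h₁ h₂ x => ?_⟩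
    have hs (e : Sec EM (F × (F →L[ℝ] ℝ)) (A ×ᵇ DualBundle A)) (he : ∀ x, e x ∈ graph I x) :
        secSnd e = I.mapSec (secFst e) := by
      apply ContMDiffSection.ext
      intro y
      obtain ⟨w, hw⟩ := he y
      obtain ⟨h1, h2⟩ := Prod.ext_iff.1 hw
      exact h2.symm.trans (congrArg (I.toFun y) h1)
    rw [B.doubleBracket_graph hI (hs e₁ h₁) (hs e₂ h₂)]
    exact ⟨_, Prod.ext rfl ((graphBracket_mem_iff B.dual B.alg hD hI (hd hI)).2 h _ _ x).symm⟩

end LieBialgebroid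

end Graphs

end

end Algebroid

theorem theorem6p1
    {EM : Type*} [NormedAddCommGroup EM] [NormedSpace ℝ EM] [FiniteDimensional ℝ EM]
    {M : Type*} [TopologicalSpace M] [T2Space M] [ChartedSpace EM M] [IsManifold 𝓘(ℝ, EM) ∞ M]
    {F : Type*} [NormedAddCommGroup F] [NormedSpace ℝ F] [FiniteDimensional ℝ F]
    {A : M → Type*} [TopologicalSpace (TotalSpace F A)] [∀ x, TopologicalSpace (A x)]
    [∀ x, AddCommGroup (A x)] [∀ x, Module ℝ (A x)]
    [∀ x, IsTopologicalAddGroup (A x)] [∀ x, ContinuousSMul ℝ (A x)]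
    [FiberBundle F A] [VectorBundle ℝ F A] [ContMDiffVectorBundle ∞ F A 𝓘(ℝ, EM)]
    (B : Algebroid.LieBialgebroid EM F A) :
    (∀ H : Algebroid.BundleMap EM (F →L[ℝ] ℝ) (Algebroid.DualBundle A) F A,
      B.IsDirac (Algebroid.graphOfDual H) ↔
        ∃ hH : H.IsSkew (Algebroid.dualPair EM F A),
          B.dual.differential (H.toBivector (Algebroid.dualPair EM F A) hH).cochain +
            (1 / 2 : ℝ) • B.alg.schouten (Algebroid.dualPair EM F A)
              (H.toBivector (Algebroid.dualPair EM F A) hH).cochain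
              (H.toBivector (Algebroid.dualPair EM F A) hH).cochain = 0) ∧
    (∀ I : Algebroid.BundleMap EM F A (F →L[ℝ] ℝ) (Algebroid.DualBundle A),
      B.IsDirac (Algebroid.graph I) ↔
        ∃ hI : I.IsSkew (Algebroid.dualPair EM F A).flip,
          B.alg.differential (I.toBivector (Algebroid.dualPair EM F A).flip hI).cochain +
            (1 / 2 : ℝ) • B.dual.schouten (Algebroid.dualPair EM F A).flip
              (I.toBivector (Algebroid.dualPair EM F A).flip hI).cochain
              (I.toBivector (Algebroid.dualPair EM F A).flip hI).cochain = 0) :=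
  ⟨B.isDirac_graphOfDual_iff, B.isDirac_graph_iff⟩
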